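/- Let $h\ge 0$ be a random channel coefficient (squared modulus) whose law $\mathfrak m$ has a density on $\mathbb R_+$ and satisfies $\mathbf E_h[\log(1+h)]<\infty$. Let $\sigma_N^2>0$ be the noise power and $R>0$ the fixed rate. Power allocations are measurable functions $P,J:\mathbb R_+\to[0,\infty)$ of the channel coefficient, and the ergodic capacity of a frame is $$C(P,J)=\mathbf E_h\Big[\log\Big(1+\frac{hP(h)}{\sigma_N^2+J(h)}\Big)\Big].$$ A frame is in outage if $C(P,J)<R$. For $j,p\ge 0$ put $$\mathscr P_M(j)=\max_{J:\ \mathbf E_h[J(h)]\le j}\ \min\{\mathbf E_h[P(h)]: C(P,J)\ge R\},\qquad \mathscr J_M(p)=\max_{P:\ \mathbf E_h[P(h)]\le p}\ \min\{\mathbf E_h[J(h)]: C(P,J)\le R\}.$$ For budgets $(a,b)$ let $G(a,b)$ be the zero-sum game in which the transmitter chooses $P$ with $\mathbf E_h[P(h)]\le a$ to maximize $C(P,J)$ and the jammer chooses $J$ with $\mathbf E_h[J(h)]\le b$ to minimize it. Consider the following intra-frame game with incomplete information. Nature draws a pair $(P_M,J_M)$ of nonnegative random frame powers, with an arbitrary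 joint law. The transmitter observes only $P_M=p_M$ and chooses $P$ with $\mathbf E_h[P(h)]\le p_M$. The jammer observes only $J_M=j_M$ and chooses $J$ with $\mathbf E_h[J(h)]\le j_M$. The transmitter minimizes and the jammer maximizes the probability of outage. A strategy of a player assigns to each own power $b\geq 0$ an allocation with mean at most $b$, jointly measurably in $b$ and $h$. A pair of strategies is a Bayes equilibrium if, for almost every own power of either player, the prescribed allocation is optimal for the conditional probability of outage given this own power, among all allocations the player can afford, when the opponent plays its prescribed strategy. Then the maxima and minima defining $\mathscr P_M(j)$ and $\mathscr J_M(p)$ are finite and attained by optimal pairs of allocations, for all $j,p\ge0$. There are jointly measurable families $p\mapsto P_1^{(p)}$ and $j\mapsto J_2^{(j)}$ such that, for every $p\ge 0$, $P_1^{(p)}$ is the transmitter's part of a Nash equilibrium of $G(p,\mathscr J_M(p))$, and, for every $j\ge 0$, $J_2^{(j)}$ is the jammer's part of a Nash equilibrium of $G(\mathscr P_M(j),j)$. For any such families, the pair of strategies in which the transmitter plays $P_1^{(p_M)}$ when it has power $p_M$, and the jammer plays $J_2^{(j_M)}$ when it has power $j_M$, is a Bayes equilibrium of the intra-frame game, whatever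 the joint law of $(P_M,J_M)$. -/

import Mathlib

open MeasureTheory ProbabilityTheory
open scoped NNReal ENNReal

noncomputable section

namespace JammingGame

/-- A power allocation over a frame: the (nonnegative) power used when the squared absolute value
of the channel coefficient equals `h`. -/
abbrev Alloc := ℝ → ℝ≥0

/-- The power `E_h[P(h)]` that an allocation spends over a frame; `𝔪` is the law of `h`. -/
def framePower (𝔪 : Measure ℝ) (P : Alloc) : ℝ≥0∞ :=
  ∫⁻ h, (P h : ℝ≥0∞) ∂𝔪

/-- The ergodic capacity `C(P, J) = E_h[log (1 + h P(h) / (σ² + J(h)))]` over a frame, with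
`σsq` the noise power. The integrand is nonnegative for `h ≥ 0`. -/
def capacity (𝔪 : Measure ℝ) (σsq : ℝ) (P J : Alloc) : ℝ≥0∞ :=
  ∫⁻ h, ENNReal.ofReal (Real.log (1 + h * (P h : ℝ) / (σsq + (J h : ℝ)))) ∂𝔪

/-- The allocations available to a player with power `b` for the frame. -/
def Affordable (𝔪 : Measure ℝ) (b : ℝ≥0∞) (P : Alloc) : Prop :=
  Measurable P ∧ framePower 𝔪 P ≤ b

/-- The frame is in outage: the ergodic capacity is below the fixed rate `R`. -/
def Outage (𝔪 : Measure ℝ) (σsq R : ℝ) (P J : Alloc) : Prop :=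
  capacity 𝔪 σsq P J < ENNReal.ofReal R

/-! ### The max-min problems of the two players -/

/-- `min E_h[P(h)]` subject to `C(P, J) ≥ R`, for a given jammer allocation `J`. -/
def minTxPower (𝔪 : Measure ℝ) (σsq R : ℝ) (J : Alloc) : ℝ≥0∞ :=
  ⨅ (P : Alloc) (_ : Measurable P ∧ ENNReal.ofReal R ≤ capacity 𝔪 σsq P J), framePower 𝔪 P

/-- `min E_h[J(h)]` subject to `C(P, J) ≤ R`, for a given transmitter allocation `P`. -/
def minJxPower (𝔪 : Measure ℝ) (σsq R : ℝ) (P : Alloc) : ℝ≥0∞ :=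
  ⨅ (J : Alloc) (_ : Measurable J ∧ capacity 𝔪 σsq P J ≤ ENNReal.ofReal R), framePower 𝔪 J

/-- `𝒫_M(j)`: the transmitter power required over a frame in which the jammer spends `j`. -/
def requiredTxPower (𝔪 : Measure ℝ) (σsq R : ℝ) (j : ℝ≥0) : ℝ≥0∞ :=
  ⨆ (J : Alloc) (_ : Affordable 𝔪 j J), minTxPower 𝔪 σsq R J

/-- `𝒥_M(p)`: the jammer power required over a frame in which the transmitter spends `p`. -/
def requiredJxPower (𝔪 : Measure ℝ) (σsq R : ℝ) (p : ℝ≥0) : ℝ≥0∞ :=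
  ⨆ (P : Alloc) (_ : Affordable 𝔪 p P), minJxPower 𝔪 σsq R P

/-- `(P, J)` is an optimal solution of
`max_{J : E[J] ≤ j} min {E[P] : C(P, J) ≥ R}`, both optima being attained. -/
structure SolvesProblem1 (𝔪 : Measure ℝ) (σsq R : ℝ) (j : ℝ≥0) (P J : Alloc) : Prop where
  affordable : Affordable 𝔪 j J
  measurable : Measurable P
  reliable : ENNReal.ofReal R ≤ capacity 𝔪 σsq P J
  inner_opt : framePower 𝔪 P = minTxPower 𝔪 σsq R J
  outer_opt : minTxPower 𝔪 σsq R J = requiredTxPower 𝔪 σsq R j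

/-- `(P, J)` is an optimal solution of
`max_{P : E[P] ≤ p} min {E[J] : C(P, J) ≤ R}`, both optima being attained. -/
structure SolvesProblem2 (𝔪 : Measure ℝ) (σsq R : ℝ) (p : ℝ≥0) (P J : Alloc) : Prop where
  affordable : Affordable 𝔪 p P
  measurable : Measurable J
  jammed : capacity 𝔪 σsq P J ≤ ENNReal.ofReal R
  inner_opt : framePower 𝔪 J = minJxPower 𝔪 σsq R P
  outer_opt : minJxPower 𝔪 σsq R P = requiredJxPower 𝔪 σsq R p

/-! ### The ergodic-capacity game with complete information -/

/-- `(P, J)` is a Nash equilibrium of the zero-sum game in which the transmitter maximizes and the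
jammer minimizes `C(P, J)`, subject to `E_h[P(h)] ≤ p` and `E_h[J(h)] ≤ j`. -/
structure IsCapacityEquilibrium (𝔪 : Measure ℝ) (σsq : ℝ) (p j : ℝ≥0∞) (P J : Alloc) : Prop where
  tx_affordable : Affordable 𝔪 p P
  jx_affordable : Affordable 𝔪 j J
  tx_best : ∀ P', Affordable 𝔪 p P' → capacity 𝔪 σsq P' J ≤ capacity 𝔪 σsq P J
  jx_best : ∀ J', Affordable 𝔪 j J' → capacity 𝔪 σsq P J ≤ capacity 𝔪 σsq P J'

/-! ### The intra-frame game with incomplete information -/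

/-- A strategy of a player in the intra-frame game: for each own frame power `b` (the type of the
player) an allocation that the player can afford, depending measurably on the type. -/
structure IsStrategy (𝔪 : Measure ℝ) (s : ℝ≥0 → Alloc) : Prop where
  measurable : Measurable (Function.uncurry s)
  affordable : ∀ b : ℝ≥0, Affordable 𝔪 b (s b)

/-- Each type `p` of the transmitter plays its part of an equilibrium of the capacity game with
transmitter budget `p` and jammer budget `𝒥_M(p)`. -/
structure IsTxEquilibriumStrategy (𝔪 : Measure ℝ) (σsq R : ℝ) (s : ℝ≥0 → Alloc) : Prop where
  measurable : Measurable (Function.uncurry s)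
  equilibrium : ∀ p : ℝ≥0, ∃ J : Alloc,
    IsCapacityEquilibrium 𝔪 σsq p (requiredJxPower 𝔪 σsq R p) (s p) J

/-- Each type `j` of the jammer plays its part of an equilibrium of the capacity game with
transmitter budget `𝒫_M(j)` and jammer budget `j`. -/
structure IsJxEquilibriumStrategy (𝔪 : Measure ℝ) (σsq R : ℝ) (t : ℝ≥0 → Alloc) : Prop where
  measurable : Measurable (Function.uncurry t)
  equilibrium : ∀ j : ℝ≥0, ∃ P : Alloc,
    IsCapacityEquilibrium 𝔪 σsq (requiredTxPower 𝔪 σsq R j) j P (t j)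

/-- Bayes equilibrium of the intra-frame game. The types are the random frame powers `P_M`, `J_M`;
each player knows only its own type. The transmitter minimizes and the jammer maximizes the
conditional probability of outage given the own type: (almost) no type can gain by switching to
another affordable allocation. -/
structure IsBayesEquilibrium {Ω : Type*} [MeasurableSpace Ω] (μ : Measure Ω) [IsFiniteMeasure μ]
    (P_M J_M : Ω → ℝ≥0) (𝔪 : Measure ℝ) (σsq R : ℝ) (s t : ℝ≥0 → Alloc) : Prop where
  tx_strategy : IsStrategy 𝔪 s
  jx_strategy : IsStrategy 𝔪 t
  tx_best : ∀ᵐ p : ℝ≥0 ∂(μ.map P_M), ∀ P : Alloc, Affordable 𝔪 (p : ℝ≥0∞) P →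
    condDistrib J_M P_M μ p {j | Outage 𝔪 σsq R (s p) (t j)} ≤
      condDistrib J_M P_M μ p {j | Outage 𝔪 σsq R P (t j)}
  jx_best : ∀ᵐ j : ℝ≥0 ∂(μ.map J_M), ∀ J : Alloc, Affordable 𝔪 (j : ℝ≥0∞) J →
    condDistrib P_M J_M μ j {p | Outage 𝔪 σsq R (s p) J} ≤
      condDistrib P_M J_M μ j {p | Outage 𝔪 σsq R (s p) (t j)}

end JammingGame

end

/-!
The game `G(a, b)` is concave-convex, and its saddle points can be written down. With `N` the noise
power, the first-order conditions lead to a two-parameter family, `u ≥ 0` and `a > 0`,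

* `J(h) = N (u h - 1)⁺ / (1 + a h)` (`jamAlloc`),
* `P(h) = (N (a + u) - (N + J(h)) / h)⁺` (`txAlloc`),
* `1 + h P(h) / (N + J(h)) = max 1 (a h + min 1 (u h))` (`snrFactor`),

with the multipliers `1 / (N (a + u))` for `E[P]` and `a / (N (a + u))` for `E[J]`. The Lagrangian
inequalities hold pointwise in `h` (`tx_pointwise`, `jx_pointwise`), and so after integration
(`isLagrangeSaddle`).

The rate of the pair strictly increases with `a` where it is positive, so that the pairs of rate
exactly `R` form a graph `a = α(u)` over `u ≥ 0`. The function `α` is antitone and `α(u) + u` is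
monotone, hence `α` is continuous (`exists_levelCurve`). If `(P, J)` lies on this curve then the
multiplier inequalities give `𝒫_M(E[J]) = E[P]` and `𝒥_M(E[P]) = E[J]`, and `(P, J)` solves both
max-min problems (`IsLagrangeSaddle.solvesProblem1`, `IsLagrangeSaddle.solvesProblem2`). The powers
`E[J]` and `E[P]` are continuous and unbounded along the curve. As `E[J] = 0` at `u = 0`, every
jammer power occurs, and so does every transmitter power from that of plain waterfilling at rate `R`
on. Below that power `𝒥_M` is zero and the equilibria of `G(p, 0)` are waterfilling without jamming.
A continuous unbounded function has a monotone right inverse (`exists_monotone_rightInverse`),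
which makes the families of equilibrium allocations measurable.

For the Bayes equilibrium no probability is needed. If `p ≥ 𝒫_M(j)`, the transmitter's equilibrium
allocation prevents the outage whatever the jammer of power `j` does
(`le_capacity_of_requiredTxPower_le`). If `p < 𝒫_M(j)`, the jammer's equilibrium allocation enforces
the outage whatever the transmitter of power `p` does (`capacity_lt_of_lt_requiredTxPower`). So the
outage events can be compared pointwise in the type of the opponent (`isBayesEquilibrium`).
-/

namespace JammingGame

/-! ### The explicit saddle points -/

/-- The jammer's allocation `J(h) = N (u h - 1)⁺ / (1 + a h)` of the two-parameter family of saddle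
points: `N` is the noise power, and the jammer is active exactly where `u h > 1`. The formula is
meant for `h > 0`, which carries the whole law of the channel. -/
noncomputable def jamAlloc (N u a : ℝ) : Alloc := fun h =>
  Real.toNNReal (N * (u * h - 1) / (1 + a * h))

/-- The transmitter's allocation `P(h) = (μ - (N + J(h)) / h)⁺` of the two-parameter family of
saddle points, waterfilling at level `μ = N (a + u)` over the noise plus `jamAlloc N u a`. For
`u = 0` this is ordinary waterfilling at level `N a`. -/
noncomputable def txAlloc (N u a : ℝ) : Alloc := fun h =>
  Real.toNNReal (N * ((a + u) - max h⁻¹ ((a + u) / (1 + a * h))))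

/-- The factor `1 + h P(h) / (N + J(h))` for the allocations `P = txAlloc N u a` and
`J = jamAlloc N u a`; it does not depend on the noise power `N` (see `one_add_snr_eq`). -/
noncomputable def snrFactor (u a h : ℝ) : ℝ := max 1 (a * h + min 1 (u * h))

lemma snrFactor_pos (u a h : ℝ) : 0 < snrFactor u a h := lt_max_of_lt_left one_pos

lemma measurable_jamAlloc (N : ℝ) :
    Measurable fun q : ℝ × ℝ × ℝ => jamAlloc N q.1 q.2.1 q.2.2 := by
  unfold jamAlloc
  fun_prop

lemma measurable_txAlloc (N : ℝ) :
    Measurable fun q : ℝ × ℝ × ℝ => txAlloc N q.1 q.2.1 q.2.2 := by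
  unfold txAlloc
  fun_prop

lemma measurable_jamAlloc_apply (N u a : ℝ) : Measurable (jamAlloc N u a) := by
  unfold jamAlloc
  fun_prop

lemma measurable_txAlloc_apply (N u a : ℝ) : Measurable (txAlloc N u a) := by
  unfold txAlloc
  fun_prop

/-! ### First-order conditions at a fixed channel coefficient -/

section Pointwise

variable {N u a h : ℝ}

lemma jamAlloc_of_le (hN : 0 < N) (ha : 0 ≤ a) (hh : 0 < h) (huh : u * h ≤ 1) :
    jamAlloc N u a h = 0 := by
  refine Real.toNNReal_of_nonpos (div_nonpos_of_nonpos_of_nonneg ?_ (by positivity))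
  exact mul_nonpos_of_nonneg_of_nonpos hN.le (by linarith)

lemma coe_jamAlloc_of_ge (hN : 0 < N) (ha : 0 ≤ a) (hh : 0 < h) (huh : 1 ≤ u * h) :
    (jamAlloc N u a h : ℝ) = N * (u * h - 1) / (1 + a * h) := by
  refine Real.coe_toNNReal _ (div_nonneg (mul_nonneg hN.le (by linarith)) (by positivity))

lemma coe_txAlloc_of_le (ha : 0 ≤ a) (hh : 0 < h) (huh : u * h ≤ 1) :
    (txAlloc N u a h : ℝ) = max (N * ((a + u) - h⁻¹)) 0 := by
  have : (a + u) / (1 + a * h) ≤ h⁻¹ := by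
    rw [div_le_iff₀ (by positivity), inv_mul_eq_div, le_div_iff₀ hh]
    linarith
  rw [txAlloc, max_eq_left this, Real.coe_toNNReal']

lemma txAlloc_zero_mono (hN : 0 < N) {b : ℝ} (hab : a ≤ b) (ha : 0 ≤ a) (hh : 0 < h) :
    (txAlloc N 0 a h : ℝ) ≤ txAlloc N 0 b h := by
  rw [coe_txAlloc_of_le ha hh (by simp), coe_txAlloc_of_le (ha.trans hab) hh (by simp)]
  gcongr

lemma txAlloc_zero_zero (hN : 0 < N) (hh : 0 < h) : txAlloc N 0 0 h = 0 := by
  have := coe_txAlloc_of_le (N := N) (u := 0) le_rfl hh (by simp)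
  rw [max_eq_right] at this
  · exact_mod_cast this
  · exact mul_nonpos_of_nonneg_of_nonpos hN.le (by simpa using hh.le)

lemma coe_txAlloc_of_ge (hN : 0 < N) (hu : 0 ≤ u) (ha : 0 ≤ a) (hh : 0 < h) (huh : 1 ≤ u * h) :
    (txAlloc N u a h : ℝ) = N * (a + u) * (a * h / (1 + a * h)) := by
  have h1 : 0 < 1 + a * h := by positivity
  have : h⁻¹ ≤ (a + u) / (1 + a * h) := by
    rw [le_div_iff₀ h1, inv_mul_eq_div, div_le_iff₀ hh]
    linarith
  have h2 : N * ((a + u) - (a + u) / (1 + a * h)) = N * (a + u) * (a * h / (1 + a * h)) := by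
    field_simp
    ring
  rw [txAlloc, max_eq_right this, h2, Real.coe_toNNReal _ (by positivity)]

lemma one_add_snr_eq (hN : 0 < N) (hu : 0 ≤ u) (ha : 0 ≤ a) (hh : 0 < h) :
    1 + h * (txAlloc N u a h : ℝ) / (N + (jamAlloc N u a h : ℝ)) = snrFactor u a h := by
  have h1 : 0 < 1 + a * h := by positivity
  rcases le_total (u * h) 1 with huh | huh
  · rw [jamAlloc_of_le hN ha hh huh, coe_txAlloc_of_le ha hh huh, snrFactor, min_eq_right huh]
    have e : N * ((a + u) - h⁻¹) = (N / h) * (a * h + u * h - 1) := by field_simp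
    rcases le_total 1 (a * h + u * h) with hc | hc
    · rw [max_eq_right hc, e, max_eq_left (mul_nonneg (by positivity) (by linarith))]
      simp
      field_simp
      ring
    · rw [max_eq_left hc, e, max_eq_right (mul_nonpos_of_nonneg_of_nonpos (by positivity)
        (by linarith))]
      simp
  · rw [coe_jamAlloc_of_ge hN ha hh huh, coe_txAlloc_of_ge hN hu ha hh huh, snrFactor,
      min_eq_left huh, max_eq_right (by nlinarith [mul_nonneg ha hh.le])]
    have h3 : N + N * (u * h - 1) / (1 + a * h) = N * (a + u) * h / (1 + a * h) := by
      field_simp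
      ring
    have h4 : 0 < a + u := by
      have : 0 < u := by
        by_contra hc
        nlinarith
      linarith
    rw [h3]
    field_simp
    ring

/-- For each `h > 0`, the power `txAlloc N u a h` maximizes the Lagrangian of the transmitter with
multiplier `1 / (N (a + u))`. By concavity of `log` this is the first-order condition. -/
lemma tx_pointwise (hN : 0 < N) (hu : 0 ≤ u) (ha : 0 < a) (hh : 0 < h) {x : ℝ} (hx : 0 ≤ x) :
    Real.log (1 + h * x / (N + (jamAlloc N u a h : ℝ))) +
        (N * (a + u))⁻¹ * (txAlloc N u a h : ℝ) ≤
      Real.log (1 + h * (txAlloc N u a h : ℝ) / (N + (jamAlloc N u a h : ℝ))) +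
        (N * (a + u))⁻¹ * x := by
  have hS := one_add_snr_eq hN hu ha.le hh
  have hS1 : 1 ≤ snrFactor u a h := le_max_left _ _
  set P : ℝ := (txAlloc N u a h : ℝ) with hP
  have hP0 : 0 ≤ P := NNReal.coe_nonneg _
  set M : ℝ := N + (jamAlloc N u a h : ℝ) with hM
  have hM0 : 0 < M := add_pos_of_pos_of_nonneg hN (NNReal.coe_nonneg _)
  set S := snrFactor u a h with hSdef
  have hS0 : 0 < S := by linarith
  have hlog : Real.log (1 + h * x / M) - Real.log S ≤ (1 + h * x / M) / S - 1 := by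
    rw [← Real.log_div (by positivity) hS0.ne']
    exact Real.log_le_sub_one_of_pos (by positivity)
  have hd : (1 + h * x / M) / S - 1 = (h / (M * S)) * (x - P) := by
    have : (1 : ℝ) = S - h * P / M := by linarith
    rw [div_sub_one hS0.ne', this]
    field_simp
    linarith
  -- the marginal rate `h / (M S)` is the multiplier where `P > 0`, and at most that where `P = 0`
  have hk : (h / (M * S)) * (x - P) ≤ (N * (a + u))⁻¹ * (x - P) := by
    have h1 : 0 < 1 + a * h := by positivity
    rcases le_total (u * h) 1 with huh | huh
    · have hMN : M = N := by rw [hM, jamAlloc_of_le hN ha.le hh huh]; simp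
      have hSe : S = max 1 (a * h + u * h) := by rw [hSdef, snrFactor, min_eq_right huh]
      rcases le_total 1 (a * h + u * h) with hc | hc
      · rw [max_eq_right hc] at hSe
        rw [hMN, hSe]
        apply le_of_eq
        field_simp
      · rw [max_eq_left hc] at hSe
        have hPz : P = 0 := by
          rw [hP, coe_txAlloc_of_le ha.le hh huh]
          refine max_eq_right (mul_nonpos_of_nonneg_of_nonpos hN.le ?_)
          rw [sub_nonpos, ← one_div, le_div_iff₀ hh]
          linarith
        rw [hPz, sub_zero]
        refine mul_le_mul_of_nonneg_right ?_ hx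
        rw [hMN, hSe, mul_one, ← one_div, div_le_div_iff₀ hN (by positivity)]
        nlinarith
    · have hSe : S = 1 + a * h := by
        rw [hSdef, snrFactor, min_eq_left huh, max_eq_right (by nlinarith [mul_pos ha hh])]; ring
      have hMe : M = N * (a + u) * h / (1 + a * h) := by
        rw [hM, coe_jamAlloc_of_ge hN ha.le hh huh]
        field_simp
        ring
      rw [hMe, hSe]
      apply le_of_eq
      field_simp
  rw [hS]
  linarith

/-- The convex function `x ↦ log (1 + c / x)` lies above its tangents. -/
lemma log_one_add_div_tangent {c x y : ℝ} (hc : 0 ≤ c) (hx : 0 < x) (hy : 0 < y) :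
    Real.log (1 + c / x) - c / (x * (x + c)) * (y - x) ≤ Real.log (1 + c / y) := by
  have e : Real.log (1 + c / x) - Real.log (1 + c / y) = Real.log (y * (x + c) / (x * (y + c))) := by
    rw [← Real.log_div (by positivity) (by positivity)]
    congr 1
    field_simp
  have hl : Real.log (y * (x + c) / (x * (y + c))) ≤ y * (x + c) / (x * (y + c)) - 1 :=
    Real.log_le_sub_one_of_pos (by positivity)
  have h2 : y * (x + c) / (x * (y + c)) - 1 ≤ c / (x * (x + c)) * (y - x) := by
    -- the difference is a square over a positive quantity
    have : c / (x * (x + c)) * (y - x) - (y * (x + c) / (x * (y + c)) - 1) =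
        c * (y - x) ^ 2 / (x * (x + c) * (y + c)) := by
      field_simp
      ring
    have : 0 ≤ c * (y - x) ^ 2 / (x * (x + c) * (y + c)) := by positivity
    linarith
  linarith

/-- For each `h > 0`, the power `jamAlloc N u a h` minimizes the Lagrangian of the jammer with
multiplier `a / (N (a + u))`. By convexity of the rate in the jamming power this is the first-order
condition. -/
lemma jx_pointwise (hN : 0 < N) (hu : 0 ≤ u) (ha : 0 < a) (hh : 0 < h) {y : ℝ} (hy : 0 ≤ y) :
    Real.log (1 + h * (txAlloc N u a h : ℝ) / (N + (jamAlloc N u a h : ℝ))) +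
        a * (N * (a + u))⁻¹ * (jamAlloc N u a h : ℝ) ≤
      Real.log (1 + h * (txAlloc N u a h : ℝ) / (N + y)) + a * (N * (a + u))⁻¹ * y := by
  have hJ0 : 0 ≤ (jamAlloc N u a h : ℝ) := NNReal.coe_nonneg _
  have hP0 : 0 ≤ (txAlloc N u a h : ℝ) := NNReal.coe_nonneg _
  have ht := log_one_add_div_tangent (mul_nonneg hh.le hP0)
    (add_pos_of_pos_of_nonneg hN hJ0) (add_pos_of_pos_of_nonneg hN hy)
  set P : ℝ := (txAlloc N u a h : ℝ) with hP
  set J : ℝ := (jamAlloc N u a h : ℝ) with hJ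
  -- the marginal loss of rate is the multiplier where `J > 0`, and at most that where `J = 0`
  have hk : h * P / ((N + J) * (N + J + h * P)) * (N + y - (N + J)) ≤
      a * (N * (a + u))⁻¹ * (y - J) := by
    have h1 : 0 < 1 + a * h := by positivity
    rw [show N + y - (N + J) = y - J by ring]
    rcases le_total (u * h) 1 with huh | huh
    · have hJz : J = 0 := by rw [hJ, jamAlloc_of_le hN ha.le hh huh]; simp
      rw [hJz, add_zero, sub_zero]
      refine mul_le_mul_of_nonneg_right ?_ hy
      have hPe := coe_txAlloc_of_le (N := N) ha.le hh huh
      rw [← hP] at hPe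
      have e : N * ((a + u) - h⁻¹) = (N / h) * (a * h + u * h - 1) := by field_simp
      rcases le_total 1 (a * h + u * h) with hc | hc
      · rw [e, max_eq_left (mul_nonneg (by positivity) (by linarith))] at hPe
        have e2 : h * P = N * (a * h + u * h - 1) := by rw [hPe]; field_simp
        rw [e2, show N + N * (a * h + u * h - 1) = N * (a + u) * h by ring,
          ← div_eq_mul_inv, div_le_div_iff₀ (by positivity) (by positivity)]
        have : 0 ≤ (1 - u * h) * (N * N * (a + u)) := mul_nonneg (by linarith) (by positivity)
        nlinarith
      · rw [e, max_eq_right (mul_nonpos_of_nonneg_of_nonpos (by positivity)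
          (by linarith))] at hPe
        rw [hPe]
        simp only [mul_zero, zero_div]
        positivity
    · have hPe := coe_txAlloc_of_ge hN hu ha.le hh huh
      have hMe : N + J = N * (a + u) * h / (1 + a * h) := by
        rw [hJ, coe_jamAlloc_of_ge hN ha.le hh huh]
        field_simp
        ring
      rw [hMe, hP, hPe]
      apply le_of_eq
      field_simp
  linarith

lemma coe_txAlloc_le (hN : 0 < N) (hu : 0 ≤ u) (ha : 0 ≤ a) (hh : 0 < h) :
    (txAlloc N u a h : ℝ) ≤ N * (a + u) := by
  rw [txAlloc, Real.coe_toNNReal']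
  refine max_le (mul_le_mul_of_nonneg_left ?_ hN.le) (by positivity)
  have : 0 ≤ max h⁻¹ ((a + u) / (1 + a * h)) := le_max_of_le_left (by positivity)
  linarith

lemma coe_jamAlloc_le (hN : 0 < N) (hu : 0 ≤ u) (ha : 0 < a) (hh : 0 < h) :
    (jamAlloc N u a h : ℝ) ≤ N * u / a := by
  rw [jamAlloc, Real.coe_toNNReal']
  refine max_le ?_ (by positivity)
  rw [div_le_div_iff₀ (by positivity) ha]
  nlinarith [mul_nonneg hN.le hu, mul_nonneg hN.le ha.le]

lemma snrFactor_le (ha : 0 ≤ a) (hh : 0 < h) : snrFactor u a h ≤ (1 + a) * (1 + h) := by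
  refine max_le (by nlinarith [mul_nonneg ha hh.le]) ?_
  nlinarith [min_le_left 1 (u * h)]

lemma abs_log_snrFactor_le (ha : 0 ≤ a) (hh : 0 < h) :
    ‖Real.log (snrFactor u a h)‖ ≤ Real.log (1 + a) + Real.log (1 + h) := by
  have h0 : 0 ≤ Real.log (snrFactor u a h) := Real.log_nonneg (le_max_left _ _)
  rw [Real.norm_of_nonneg h0,
    ← Real.log_mul (by positivity) (by positivity)]
  exact Real.log_le_log (snrFactor_pos _ _ _) (snrFactor_le ha hh)

end Pointwise

/-! ### The rate along the family and its level curve -/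

section Channel

variable {𝔪 : Measure ℝ} [IsProbabilityMeasure 𝔪]

/-- Continuity of a parametric integral whose integrand is dominated by an integrable function plus
a continuous function of the parameter. -/
lemma continuous_integral_of_locally_bounded {F : ℝ → ℝ → ℝ} {B : ℝ → ℝ} {G : ℝ → ℝ}
    (hB : Continuous B) (hG : Integrable G 𝔪) (hm : ∀ x, AEStronglyMeasurable (F x) 𝔪)
    (hb : ∀ x, ∀ᵐ h ∂𝔪, ‖F x h‖ ≤ B x + G h) (hc : ∀ᵐ h ∂𝔪, Continuous fun x => F x h) :
    Continuous fun x => ∫ h, F x h ∂𝔪 := by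
  rw [continuous_iff_continuousAt]
  intro x₀
  refine continuousAt_of_dominated (bound := fun h => (B x₀ + 1) + G h)
    (Filter.Eventually.of_forall hm) ?_ ((integrable_const _).add hG)
    (hc.mono fun h hh => hh.continuousAt)
  filter_upwards [hB.continuousAt.eventually_lt_const (lt_add_one (B x₀))] with x hx
  filter_upwards [hb x] with h hh
  linarith

/-- The ergodic capacity of the pair `txAlloc N u a`, `jamAlloc N u a` as a real number, the mean of
`log (snrFactor u a h)` (see `capacity_txAlloc_jamAlloc`). -/
noncomputable def meanRate (𝔪 : Measure ℝ) (u a : ℝ) : ℝ := ∫ h, Real.log (snrFactor u a h) ∂𝔪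

lemma measurable_log_snrFactor (u a : ℝ) : Measurable fun h => Real.log (snrFactor u a h) := by
  unfold snrFactor
  fun_prop

lemma integrable_log_snrFactor (h_pos : ∀ᵐ h ∂𝔪, 0 < h)
    (h_log : Integrable (fun h : ℝ => Real.log (1 + h)) 𝔪) (u : ℝ) {a : ℝ} (ha : 0 ≤ a) :
    Integrable (fun h => Real.log (snrFactor u a h)) 𝔪 := by
  refine ((integrable_const (Real.log (1 + a))).add h_log).mono'
    (measurable_log_snrFactor u a).aestronglyMeasurable ?_
  filter_upwards [h_pos] with h hh
  exact abs_log_snrFactor_le ha hh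

lemma meanRate_mono (h_pos : ∀ᵐ h ∂𝔪, 0 < h)
    (h_log : Integrable (fun h : ℝ => Real.log (1 + h)) 𝔪) {u a u' a' : ℝ}
    (ha : 0 ≤ a) (ha' : 0 ≤ a') (hle : ∀ h, 0 < h → a * h + min 1 (u * h) ≤ a' * h + min 1 (u' * h)) :
    meanRate 𝔪 u a ≤ meanRate 𝔪 u' a' := by
  refine integral_mono_ae (integrable_log_snrFactor h_pos h_log u ha)
    (integrable_log_snrFactor h_pos h_log u' ha') ?_
  filter_upwards [h_pos] with h hh
  exact Real.log_le_log (snrFactor_pos _ _ _) (max_le_max le_rfl (hle h hh))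

/-- The mean rate is strictly increasing in the slope `a` as long as it is positive. -/
lemma meanRate_lt (h_pos : ∀ᵐ h ∂𝔪, 0 < h)
    (h_log : Integrable (fun h : ℝ => Real.log (1 + h)) 𝔪) {u a a' : ℝ}
    (ha : 0 ≤ a) (hlt : a < a') (hpos : 0 < meanRate 𝔪 u a) :
    meanRate 𝔪 u a < meanRate 𝔪 u a' := by
  have hm := meanRate_mono h_pos h_log (u := u) (u' := u) ha (ha.trans hlt.le)
    (fun h hh => by nlinarith)
  refine lt_of_le_of_ne hm fun heq => ?_
  have hle : (fun h => Real.log (snrFactor u a h)) ≤ᵐ[𝔪] fun h => Real.log (snrFactor u a' h) := by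
    filter_upwards [h_pos] with h hh
    exact Real.log_le_log (snrFactor_pos _ _ _) (max_le_max le_rfl (by nlinarith))
  have hae := (integral_eq_iff_of_ae_le (integrable_log_snrFactor h_pos h_log u ha)
    (integrable_log_snrFactor h_pos h_log u (ha.trans hlt.le)) hle).1 heq
  -- where the two integrands agree, neither exceeds the threshold `1`, so the first one vanishes
  have hz : (fun h => Real.log (snrFactor u a h)) =ᵐ[𝔪] 0 := by
    filter_upwards [h_pos, hae] with h hh he
    have he' := Real.log_injOn_pos (snrFactor_pos u a h) (snrFactor_pos u a' h) he
    have h1 : a * h < a' * h := by nlinarith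
    have h2 : a * h + min 1 (u * h) ≤ 1 := by
      by_contra hc
      rw [not_le] at hc
      simp only [snrFactor] at he'
      rw [max_eq_right hc.le, max_eq_right (by linarith)] at he'
      linarith
    simp [snrFactor, max_eq_left h2]
  rw [meanRate, integral_congr_ae hz] at hpos
  simp at hpos

lemma continuous_meanRate (h_pos : ∀ᵐ h ∂𝔪, 0 < h)
    (h_log : Integrable (fun h : ℝ => Real.log (1 + h)) 𝔪) (u : ℝ) :
    Continuous fun x => meanRate 𝔪 u (max x 0) := by
  refine continuous_integral_of_locally_bounded (B := fun x => Real.log (1 + max x 0)) ?_ h_log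
    (fun x => (measurable_log_snrFactor u _).aestronglyMeasurable) ?_ ?_
  · refine Continuous.log (by fun_prop) fun x => ?_
    have := le_max_right x 0
    linarith
  · intro x
    filter_upwards [h_pos] with h hh
    exact abs_log_snrFactor_le (le_max_right _ _) hh
  · refine Filter.Eventually.of_forall fun h => Continuous.log ?_ fun x => (snrFactor_pos _ _ _).ne'
    unfold snrFactor
    fun_prop

lemma exists_measureReal_Ici_pos (h_pos : ∀ᵐ h ∂𝔪, 0 < h) :
    ∃ δ : ℝ, 0 < δ ∧ 0 < 𝔪.real (Set.Ici δ) := by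
  by_contra! hc
  have hz : ∀ n : ℕ, 𝔪 (Set.Ici ((1 : ℝ) / (n + 1))) = 0 := fun n => by
    have := le_antisymm (hc (1 / (n + 1)) (by positivity)) measureReal_nonneg
    rwa [measureReal_eq_zero_iff] at this
  have hall : 𝔪 (⋃ n : ℕ, Set.Ici ((1 : ℝ) / (n + 1))) = 0 := measure_iUnion_null hz
  have hnot : ∀ᵐ h ∂𝔪, False := by
    filter_upwards [h_pos, measure_eq_zero_iff_ae_notMem.1 hall] with h hh hn
    obtain ⟨n, hn'⟩ := exists_nat_one_div_lt hh
    exact hn (Set.mem_iUnion.2 ⟨n, hn'.le⟩)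
  exact IsProbabilityMeasure.ne_zero 𝔪 (by simpa using hnot)

/-- Lower bound for the mean of a nonnegative function that is at least `c` on `[δ, ∞)`. -/
lemma mul_measureReal_Ici_le_integral {f : ℝ → ℝ} (hf : Integrable f 𝔪) (h0 : ∀ᵐ h ∂𝔪, 0 ≤ f h)
    {c δ : ℝ} (hc : ∀ h, δ ≤ h → c ≤ f h) : c * 𝔪.real (Set.Ici δ) ≤ ∫ h, f h ∂𝔪 := by
  have h1 : ∫ h, (Set.Ici δ).indicator (fun _ => c) h ∂𝔪 = c * 𝔪.real (Set.Ici δ) := by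
    rw [integral_indicator_const c measurableSet_Ici, smul_eq_mul, mul_comm]
  rw [← h1]
  refine integral_mono_ae ((integrable_const c).indicator measurableSet_Ici) hf ?_
  filter_upwards [h0] with h hh
  by_cases hd : h ∈ Set.Ici δ
  · simpa [Set.indicator_of_mem hd] using hc h hd
  · simpa [Set.indicator_of_notMem hd] using hh

lemma exists_meanRate_eq (h_pos : ∀ᵐ h ∂𝔪, 0 < h)
    (h_log : Integrable (fun h : ℝ => Real.log (1 + h)) 𝔪) {R : ℝ} (hR : 0 < R)
    {u : ℝ} (hu : 0 ≤ u) : ∃ a, 0 < a ∧ meanRate 𝔪 u a = R := by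
  obtain ⟨δ, hδ, hm⟩ := exists_measureReal_Ici_pos h_pos
  have hcont := continuous_meanRate h_pos h_log u
  have h0 : meanRate 𝔪 u (max 0 0) = 0 := by simp [meanRate, snrFactor]
  -- large enough for the rate on `[δ, ∞)` alone to give the mean `R`
  set b := Real.exp (R / 𝔪.real (Set.Ici δ)) / δ with hb
  have hb0 : 0 < b := by positivity
  have h1 : R ≤ meanRate 𝔪 u (max b 0) := by
    rw [max_eq_left hb0.le]
    calc R = R / 𝔪.real (Set.Ici δ) * 𝔪.real (Set.Ici δ) := by field_simp
      _ ≤ _ := by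
        refine mul_measureReal_Ici_le_integral (integrable_log_snrFactor h_pos h_log u hb0.le)
          (Filter.Eventually.of_forall fun h => Real.log_nonneg (le_max_left _ _)) fun h hh => ?_
        rw [Real.le_log_iff_exp_le (snrFactor_pos _ _ _)]
        refine le_max_of_le_right ?_
        have e : Real.exp (R / 𝔪.real (Set.Ici δ)) = b * δ := by rw [hb]; field_simp
        have : 0 ≤ min 1 (u * h) := le_min one_pos.le (mul_nonneg hu (hδ.le.trans hh))
        rw [e]
        nlinarith
  obtain ⟨a, ha, hae⟩ := intermediate_value_Icc hb0.le hcont.continuousOn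
    (show R ∈ Set.Icc _ _ from ⟨by simp only [h0]; exact hR.le, h1⟩)
  have ha0 : 0 < a := by
    rcases ha.1.eq_or_lt with h | h
    · rw [← h] at hae
      simp only [h0] at hae
      linarith
    · exact h
  exact ⟨a, ha0, by simpa [max_eq_left ha0.le] using hae⟩

/-- The level curve `meanRate u a = R`, as a graph over `u ≥ 0`. -/
lemma exists_levelCurve (h_pos : ∀ᵐ h ∂𝔪, 0 < h)
    (h_log : Integrable (fun h : ℝ => Real.log (1 + h)) 𝔪) {R : ℝ} (hR : 0 < R) :
    ∃ α : ℝ → ℝ, Continuous α ∧ Antitone α ∧ (∀ u, 0 < α u) ∧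
      ∀ u, 0 ≤ u → meanRate 𝔪 u (α u) = R := by
  have hex : ∀ u : ℝ, ∃ a, 0 < a ∧ meanRate 𝔪 (max u 0) a = R := fun u =>
    exists_meanRate_eq h_pos h_log hR (le_max_right u 0)
  choose α hα0 hα using hex
  have hanti : Antitone α := by
    intro u v huv
    by_contra! hc
    have h1 := meanRate_lt h_pos h_log (hα0 u).le hc (by rw [hα]; exact hR)
    have h2 := meanRate_mono h_pos h_log (u := max u 0) (u' := max v 0) (hα0 v).le (hα0 v).le
      fun h hh => by gcongr
    rw [hα] at h1 h2
    linarith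
  -- increasing `u` with `a + u` fixed decreases the rate, so `α u + u` is monotone
  have hmono : ∀ u v, u ≤ v → α u + max u 0 ≤ α v + max v 0 := by
    intro u v huv
    by_contra! hc
    have huv' : max u 0 ≤ max v 0 := max_le_max huv le_rfl
    have hlt : α v < α u + max u 0 - max v 0 := by linarith
    have h1 := meanRate_lt h_pos h_log (hα0 v).le hlt (by rw [hα]; exact hR)
    have h2 := meanRate_mono h_pos h_log (u := max v 0) (u' := max u 0)
      ((hα0 v).trans hlt).le (hα0 u).le fun h hh => by
        rcases min_cases 1 (max v 0 * h) with ⟨h3, h4⟩ | ⟨h3, h4⟩ <;>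
        rcases min_cases 1 (max u 0 * h) with ⟨h5, h6⟩ | ⟨h5, h6⟩ <;>
        rw [h3, h5] <;> nlinarith
    rw [hα] at h1 h2
    linarith
  refine ⟨α, ?_, hanti, hα0, fun u hu => by simpa [max_eq_left hu] using hα u⟩
  -- both monotonicities together make `α` 1-Lipschitz
  have hlip : LipschitzWith 1 α := by
    refine LipschitzWith.of_le_add fun u v => ?_
    rcases le_total u v with huv | huv
    · have h1 := hmono u v huv
      have h2 : max v 0 ≤ max u 0 + (v - u) :=
        max_le (by linarith [le_max_left u 0]) (by linarith [le_max_right u 0])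
      rw [Real.dist_eq, abs_sub_comm, abs_of_nonneg (by linarith)]
      linarith
    · have := hanti huv
      have := dist_nonneg (x := u) (y := v)
      linarith
  exact hlip.continuous

variable {N : ℝ}

/-- Along the level curve `a` is bounded away from `0`, since the mean rate is at most
`E log (1 + a h)`. -/
lemma exists_pos_le_of_meanRate_eq (h_pos : ∀ᵐ h ∂𝔪, 0 < h)
    (h_log : Integrable (fun h : ℝ => Real.log (1 + h)) 𝔪) {R : ℝ} (hR : 0 < R) :
    ∃ a₁, 0 < a₁ ∧ ∀ u a, 0 ≤ a → meanRate 𝔪 u a = R → a₁ ≤ a := by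
  -- the limiting rate `E log (1 + a h)` is continuous in `a` and vanishes at `0`
  have hcont : Continuous fun x => ∫ h, Real.log (1 + max x 0 * max h 0) ∂𝔪 := by
    have hpos : ∀ x h : ℝ, 0 < 1 + max x 0 * max h 0 := fun x h => by positivity
    refine continuous_integral_of_locally_bounded (B := fun x => Real.log (1 + max x 0)) ?_ h_log
      (fun x => Measurable.aestronglyMeasurable (by fun_prop)) ?_ ?_
    · refine Continuous.log (by fun_prop) fun x => ?_
      have := le_max_right x 0
      linarith
    · intro x
      filter_upwards [h_pos] with h hh
      have hx := le_max_right x 0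
      have hxh := mul_nonneg hx hh.le
      rw [max_eq_left hh.le, Real.norm_of_nonneg (Real.log_nonneg (by linarith)),
        ← Real.log_mul (by positivity) (by positivity)]
      exact Real.log_le_log (by positivity) (by nlinarith)
    · exact Filter.Eventually.of_forall fun h =>
        Continuous.log (by fun_prop) fun x => (hpos x h).ne'
  have hev : ∀ᶠ x in nhds (0 : ℝ), ∫ h, Real.log (1 + max x 0 * max h 0) ∂𝔪 < R :=
    hcont.continuousAt.eventually_lt_const (by simpa using hR)
  obtain ⟨ε, hε, hball⟩ := Metric.eventually_nhds_iff.1 hev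
  refine ⟨ε, hε, fun u a ha hrate => ?_⟩
  by_contra! hc
  have h1 := hball (show dist a 0 < ε by rwa [Real.dist_eq, sub_zero, abs_of_nonneg ha])
  have h2 : meanRate 𝔪 u a ≤ ∫ h, Real.log (1 + max a 0 * max h 0) ∂𝔪 := by
    refine integral_mono_ae (integrable_log_snrFactor h_pos h_log u ha) ?_ ?_
    · refine ((integrable_const (Real.log (1 + a))).add h_log).mono'
        (Measurable.aestronglyMeasurable (by fun_prop)) ?_
      filter_upwards [h_pos] with h hh
      have hxh := mul_nonneg ha hh.le
      rw [max_eq_left hh.le, max_eq_left ha, Real.norm_of_nonneg (Real.log_nonneg (by linarith)),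
        Pi.add_apply, ← Real.log_mul (by positivity) (by positivity)]
      exact Real.log_le_log (by positivity) (by nlinarith)
    · filter_upwards [h_pos] with h hh
      rw [max_eq_left hh.le, max_eq_left ha]
      refine Real.log_le_log (snrFactor_pos _ _ _) (max_le ?_ ?_)
      · have := mul_nonneg ha hh.le
        linarith
      · linarith [min_le_left 1 (u * h)]
  linarith

/-! ### Mean powers of the allocations -/

lemma integrable_txAlloc (h_pos : ∀ᵐ h ∂𝔪, 0 < h) (hN : 0 < N) {u a : ℝ} (hu : 0 ≤ u)
    (ha : 0 ≤ a) : Integrable (fun h => (txAlloc N u a h : ℝ)) 𝔪 := by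
  refine (integrable_const (N * (a + u))).mono'
    (measurable_txAlloc_apply N u a).coe_nnreal_real.aestronglyMeasurable ?_
  filter_upwards [h_pos] with h hh
  rw [Real.norm_of_nonneg (NNReal.coe_nonneg _)]
  exact coe_txAlloc_le hN hu ha hh

lemma integrable_jamAlloc (h_pos : ∀ᵐ h ∂𝔪, 0 < h) (hN : 0 < N) {u a : ℝ} (hu : 0 ≤ u)
    (ha : 0 < a) : Integrable (fun h => (jamAlloc N u a h : ℝ)) 𝔪 := by
  refine (integrable_const (N * u / a)).mono'
    (measurable_jamAlloc_apply N u a).coe_nnreal_real.aestronglyMeasurable ?_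
  filter_upwards [h_pos] with h hh
  rw [Real.norm_of_nonneg (NNReal.coe_nonneg _)]
  exact coe_jamAlloc_le hN hu ha hh

lemma continuous_integral_txAlloc (h_pos : ∀ᵐ h ∂𝔪, 0 < h) (hN : 0 < N) {U A : ℝ → ℝ}
    (hU : Continuous U) (hA : Continuous A) (hU0 : ∀ x, 0 ≤ U x) (hA0 : ∀ x, 0 ≤ A x) :
    Continuous fun x => ∫ h, (txAlloc N (U x) (A x) h : ℝ) ∂𝔪 := by
  refine continuous_integral_of_locally_bounded (B := fun x => N * (A x + U x)) (G := 0)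
    (by fun_prop) (integrable_zero _ _ _)
    (fun x => (measurable_txAlloc_apply N _ _).coe_nnreal_real.aestronglyMeasurable) ?_ ?_
  · intro x
    filter_upwards [h_pos] with h hh
    rw [Real.norm_of_nonneg (NNReal.coe_nonneg _)]
    simpa using coe_txAlloc_le hN (hU0 x) (hA0 x) hh
  · filter_upwards [h_pos] with h hh
    have hne : ∀ x, 1 + A x * h ≠ 0 := fun x => by
      have := mul_nonneg (hA0 x) hh.le
      linarith
    simp only [txAlloc, Real.coe_toNNReal']
    fun_prop (disch := exact hne)

lemma continuous_integral_jamAlloc (h_pos : ∀ᵐ h ∂𝔪, 0 < h) (hN : 0 < N) {U A : ℝ → ℝ}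
    (hU : Continuous U) (hA : Continuous A) (hU0 : ∀ x, 0 ≤ U x) (hA0 : ∀ x, 0 < A x) :
    Continuous fun x => ∫ h, (jamAlloc N (U x) (A x) h : ℝ) ∂𝔪 := by
  refine continuous_integral_of_locally_bounded (B := fun x => N * U x / A x) (G := 0)
    ((continuous_const.mul hU).div hA fun x => (hA0 x).ne') (integrable_zero _ _ _)
    (fun x => (measurable_jamAlloc_apply N _ _).coe_nnreal_real.aestronglyMeasurable) ?_ ?_
  · intro x
    filter_upwards [h_pos] with h hh
    rw [Real.norm_of_nonneg (NNReal.coe_nonneg _)]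
    simpa using coe_jamAlloc_le hN (hU0 x) (hA0 x) hh
  · filter_upwards [h_pos] with h hh
    have hne : ∀ x, 1 + A x * h ≠ 0 := fun x => by
      have := mul_nonneg (hA0 x).le hh.le
      linarith
    simp only [jamAlloc, Real.coe_toNNReal']
    fun_prop (disch := exact hne)

lemma integral_jamAlloc_unbounded (h_pos : ∀ᵐ h ∂𝔪, 0 < h) (hN : 0 < N) {A : ℝ → ℝ} {b : ℝ}
    (hA0 : ∀ x, 0 < A x) (hA : ∀ x, 0 ≤ x → A x ≤ b) (M : ℝ) :
    ∃ u, 0 ≤ u ∧ M ≤ ∫ h, (jamAlloc N u (A u) h : ℝ) ∂𝔪 := by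
  obtain ⟨δ, hδ, hm⟩ := exists_measureReal_Ici_pos h_pos
  set m := 𝔪.real (Set.Ici δ)
  have hb : 0 < b := (hA0 0).trans_le (hA 0 le_rfl)
  set K := max M 0 * (1 + b * δ) / (N * m) with hK
  have hK0 : 0 ≤ K := by positivity
  have hu : 0 ≤ (K + 1) / δ := by positivity
  refine ⟨(K + 1) / δ, hu, (le_max_left M 0).trans ?_⟩
  set u := (K + 1) / δ with hudef
  have huδ : u * δ = K + 1 := by rw [hudef]; field_simp
  have e : max M 0 = (N * K / (1 + b * δ)) * m := by rw [hK]; field_simp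
  rw [e]
  refine mul_measureReal_Ici_le_integral (integrable_jamAlloc h_pos hN hu (hA0 u))
    (Filter.Eventually.of_forall fun h => NNReal.coe_nonneg _) fun h hh => ?_
  have hh0 : 0 < h := hδ.trans_le hh
  have huh : K + 1 ≤ u * h := by rw [← huδ]; gcongr
  rw [coe_jamAlloc_of_ge hN (hA0 u).le hh0 (by linarith)]
  have h1 : 0 < 1 + A u * h := by have := mul_pos (hA0 u) hh0; linarith
  calc N * K / (1 + b * δ) ≤ N * (u * h - 1) / (1 + b * h) := by
        rw [div_le_div_iff₀ (by positivity) (by positivity), show K = u * δ - 1 by linarith]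
        have : 0 ≤ N * ((b + u) * (h - δ)) := by
          have := sub_nonneg.2 hh
          positivity
        nlinarith
    _ ≤ N * (u * h - 1) / (1 + A u * h) := by
        refine div_le_div_of_nonneg_left (mul_nonneg hN.le (by linarith)) h1 ?_
        have := hA u hu
        gcongr

lemma integral_txAlloc_unbounded (h_pos : ∀ᵐ h ∂𝔪, 0 < h) (hN : 0 < N) {A : ℝ → ℝ} {a₁ : ℝ}
    (ha₁ : 0 < a₁) (hA : ∀ x, 0 ≤ x → a₁ ≤ A x) (M : ℝ) :
    ∃ u, 0 ≤ u ∧ M ≤ ∫ h, (txAlloc N u (A u) h : ℝ) ∂𝔪 := by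
  obtain ⟨δ, hδ, hm⟩ := exists_measureReal_Ici_pos h_pos
  set m := 𝔪.real (Set.Ici δ)
  set κ := a₁ * δ / (1 + a₁ * δ) with hκ
  have hκ0 : 0 < κ := by positivity
  set K := max M 0 / (N * κ * m) with hK
  have hK0 : 0 ≤ K := by positivity
  have hu : 0 ≤ K + 1 / δ := by positivity
  refine ⟨K + 1 / δ, hu, (le_max_left M 0).trans ?_⟩
  set u := K + 1 / δ with hudef
  have hA0 : 0 < A u := ha₁.trans_le (hA u hu)
  have e : max M 0 = (N * K * κ) * m := by rw [hK]; field_simp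
  rw [e]
  refine mul_measureReal_Ici_le_integral (integrable_txAlloc h_pos hN hu hA0.le)
    (Filter.Eventually.of_forall fun h => NNReal.coe_nonneg _) fun h hh => ?_
  have hh0 : 0 < h := hδ.trans_le hh
  have huh : 1 ≤ u * h := by
    calc (1 : ℝ) = 1 / δ * δ := by field_simp
      _ ≤ u * h := by gcongr; linarith
  rw [coe_txAlloc_of_ge hN hu hA0.le hh0 huh]
  have hκ' : κ ≤ A u * h / (1 + A u * h) := by
    rw [hκ, div_le_div_iff₀ (by positivity) (by positivity)]
    have : a₁ * δ ≤ A u * h := mul_le_mul (hA u hu) hh hδ.le hA0.le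
    nlinarith
  have hKu : K ≤ A u + u := by
    have : 0 < 1 / δ := by positivity
    linarith
  gcongr

/-! ### Monotone right inverses -/

/-- A continuous unbounded function vanishing at `0` has a monotone, hence measurable, right inverse
on the nonnegative reals, namely `y ↦ min {x | y ≤ f x}`. The function itself need not be
monotone. -/
lemma exists_monotone_rightInverse {f : ℝ → ℝ} (hf : Continuous f) (h0 : f 0 = 0)
    (hunb : ∀ M, ∃ x, 0 ≤ x ∧ M ≤ f x) :
    ∃ g : ℝ≥0 → ℝ, Monotone g ∧ ∀ y, 0 ≤ g y ∧ f (g y) = y := by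
  have hbdd : ∀ y : ℝ≥0, BddBelow {x | 0 ≤ x ∧ (y : ℝ) ≤ f x} := fun y => ⟨0, fun x hx => hx.1⟩
  have hne : ∀ y : ℝ≥0, {x | 0 ≤ x ∧ (y : ℝ) ≤ f x}.Nonempty := fun y => hunb y
  have hcl : ∀ y : ℝ≥0, IsClosed {x | 0 ≤ x ∧ (y : ℝ) ≤ f x} := fun y =>
    (isClosed_le continuous_const continuous_id).inter (isClosed_le continuous_const hf)
  refine ⟨fun y => sInf {x | 0 ≤ x ∧ (y : ℝ) ≤ f x}, fun y z hyz => ?_, fun y => ?_⟩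
  · exact csInf_le_csInf (hbdd y) (hne z) fun x hx => ⟨hx.1, (NNReal.coe_le_coe.2 hyz).trans hx.2⟩
  · obtain ⟨hx0, hxy⟩ := (hcl y).csInf_mem (hne y) (hbdd y)
    refine ⟨hx0, le_antisymm ?_ hxy⟩
    obtain ⟨x', hx', hfx'⟩ := intermediate_value_Icc hx0 hf.continuousOn
      (show (y : ℝ) ∈ Set.Icc _ _ from ⟨by rw [h0]; exact y.coe_nonneg, hxy⟩)
    have : sInf {x | 0 ≤ x ∧ (y : ℝ) ≤ f x} ≤ x' := csInf_le (hbdd y) ⟨hx'.1, hfx'.ge⟩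
    have hx : x' = sInf {x | 0 ≤ x ∧ (y : ℝ) ≤ f x} := le_antisymm hx'.2 this
    exact (hx ▸ hfx').le

end Channel

/-! ### Saddle points with multipliers solve the max-min problems -/

/-- A saddle point of the capacity with positive Lagrange multipliers: `P` maximizes
`C(·, J) - l E[·]` and `J` minimizes `C(P, ·) + l' E[·]` over all allocations, whatever their
power. The differences are cleared, so that the inequalities make sense in `ℝ≥0∞`. -/
structure IsLagrangeSaddle (𝔪 : Measure ℝ) (N : ℝ) (P J : Alloc) : Prop where
  tx_measurable : Measurable P
  jx_measurable : Measurable J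
  tx_finite : framePower 𝔪 P ≠ ∞
  jx_finite : framePower 𝔪 J ≠ ∞
  capacity_finite : capacity 𝔪 N P J ≠ ∞
  tx_multiplier : ∃ l : ℝ≥0, l ≠ 0 ∧ ∀ P', Measurable P' →
    capacity 𝔪 N P' J + l * framePower 𝔪 P ≤ capacity 𝔪 N P J + l * framePower 𝔪 P'
  jx_multiplier : ∃ l : ℝ≥0, l ≠ 0 ∧ ∀ J', Measurable J' →
    capacity 𝔪 N P J + l * framePower 𝔪 J ≤ capacity 𝔪 N P J' + l * framePower 𝔪 J'

lemma le_of_add_mul_le_add_mul {c c' : ℝ≥0∞} {x x' : ℝ≥0∞} {l : ℝ≥0}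
    (h : c' + l * x ≤ c + l * x') (hx : x' ≤ x) (hfin : x ≠ ∞) : c' ≤ c := by
  have h2 : c' + l * x ≤ c + l * x := h.trans (by gcongr)
  exact (ENNReal.add_le_add_iff_right (ENNReal.mul_ne_top ENNReal.coe_ne_top hfin)).1 h2

lemma le_of_add_mul_le_add_mul_of_le {c c' : ℝ≥0∞} {x x' : ℝ≥0∞} {l : ℝ≥0} (hl : l ≠ 0)
    (h : c' + l * x ≤ c + l * x') (hc : c ≤ c') (hfin : c ≠ ∞) : x ≤ x' := by
  have h2 : c + l * x ≤ c + l * x' := le_trans (by gcongr) h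
  have h3 := (ENNReal.add_le_add_iff_left hfin).1 h2
  exact (ENNReal.mul_le_mul_iff_right (by exact_mod_cast hl) ENNReal.coe_ne_top).1 h3

namespace IsLagrangeSaddle

variable {𝔪 : Measure ℝ} {N R : ℝ} {P J : Alloc}

lemma capacity_le (hs : IsLagrangeSaddle 𝔪 N P J) {P' : Alloc} (hP' : Measurable P')
    (hle : framePower 𝔪 P' ≤ framePower 𝔪 P) : capacity 𝔪 N P' J ≤ capacity 𝔪 N P J := by
  obtain ⟨l, -, hl⟩ := hs.tx_multiplier
  exact le_of_add_mul_le_add_mul (hl P' hP') hle hs.tx_finite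

lemma le_capacity (hs : IsLagrangeSaddle 𝔪 N P J) {J' : Alloc} (hJ' : Measurable J')
    (hle : framePower 𝔪 J' ≤ framePower 𝔪 J) : capacity 𝔪 N P J ≤ capacity 𝔪 N P J' := by
  obtain ⟨l, -, hl⟩ := hs.jx_multiplier
  exact le_of_add_mul_le_add_mul (hl J' hJ') hle hs.jx_finite

lemma framePower_tx_le (hs : IsLagrangeSaddle 𝔪 N P J) {P' : Alloc} (hP' : Measurable P')
    (hle : capacity 𝔪 N P J ≤ capacity 𝔪 N P' J) : framePower 𝔪 P ≤ framePower 𝔪 P' := by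
  obtain ⟨l, hl0, hl⟩ := hs.tx_multiplier
  exact le_of_add_mul_le_add_mul_of_le hl0 (hl P' hP') hle hs.capacity_finite

lemma framePower_jx_le (hs : IsLagrangeSaddle 𝔪 N P J) {J' : Alloc} (hJ' : Measurable J')
    (hle : capacity 𝔪 N P J' ≤ capacity 𝔪 N P J) : framePower 𝔪 J ≤ framePower 𝔪 J' := by
  obtain ⟨l, hl0, hl⟩ := hs.jx_multiplier
  exact le_of_add_mul_le_add_mul_of_le hl0 (hl J' hJ') hle (ne_top_of_le_ne_top hs.capacity_finite hle)

lemma isCapacityEquilibrium (hs : IsLagrangeSaddle 𝔪 N P J) :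
    IsCapacityEquilibrium 𝔪 N (framePower 𝔪 P) (framePower 𝔪 J) P J where
  tx_affordable := ⟨hs.tx_measurable, le_rfl⟩
  jx_affordable := ⟨hs.jx_measurable, le_rfl⟩
  tx_best _ h := hs.capacity_le h.1 h.2
  jx_best _ h := hs.le_capacity h.1 h.2

lemma minTxPower_eq (hs : IsLagrangeSaddle 𝔪 N P J)
    (hR : capacity 𝔪 N P J = ENNReal.ofReal R) : minTxPower 𝔪 N R J = framePower 𝔪 P := by
  refine le_antisymm (iInf₂_le P ⟨hs.tx_measurable, hR.ge⟩) (le_iInf₂ fun P' hP' => ?_)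
  exact hs.framePower_tx_le hP'.1 (hR ▸ hP'.2)

lemma minJxPower_eq (hs : IsLagrangeSaddle 𝔪 N P J)
    (hR : capacity 𝔪 N P J = ENNReal.ofReal R) : minJxPower 𝔪 N R P = framePower 𝔪 J := by
  refine le_antisymm (iInf₂_le J ⟨hs.jx_measurable, hR.le⟩) (le_iInf₂ fun J' hJ' => ?_)
  exact hs.framePower_jx_le hJ'.1 (hR ▸ hJ'.2)

lemma requiredTxPower_eq (hs : IsLagrangeSaddle 𝔪 N P J)
    (hR : capacity 𝔪 N P J = ENNReal.ofReal R) {j : ℝ≥0} (hj : framePower 𝔪 J = j) :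
    requiredTxPower 𝔪 N R j = framePower 𝔪 P := by
  refine le_antisymm (iSup₂_le fun J' hJ' => ?_) ?_
  · exact iInf₂_le P ⟨hs.tx_measurable, hR ▸ hs.le_capacity hJ'.1 (hj ▸ hJ'.2)⟩
  · rw [← hs.minTxPower_eq hR]
    exact le_iSup₂_of_le J ⟨hs.jx_measurable, hj.le⟩ le_rfl

lemma requiredJxPower_eq (hs : IsLagrangeSaddle 𝔪 N P J)
    (hR : capacity 𝔪 N P J = ENNReal.ofReal R) {p : ℝ≥0} (hp : framePower 𝔪 P = p) :
    requiredJxPower 𝔪 N R p = framePower 𝔪 J := by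
  refine le_antisymm (iSup₂_le fun P' hP' => ?_) ?_
  · exact iInf₂_le J ⟨hs.jx_measurable, hR ▸ hs.capacity_le hP'.1 (hp ▸ hP'.2)⟩
  · rw [← hs.minJxPower_eq hR]
    exact le_iSup₂_of_le P ⟨hs.tx_measurable, hp.le⟩ le_rfl

lemma solvesProblem1 (hs : IsLagrangeSaddle 𝔪 N P J)
    (hR : capacity 𝔪 N P J = ENNReal.ofReal R) {j : ℝ≥0} (hj : framePower 𝔪 J = j) :
    SolvesProblem1 𝔪 N R j P J where
  affordable := ⟨hs.jx_measurable, hj.le⟩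
  measurable := hs.tx_measurable
  reliable := hR.ge
  inner_opt := (hs.minTxPower_eq hR).symm
  outer_opt := (hs.minTxPower_eq hR).trans (hs.requiredTxPower_eq hR hj).symm

lemma solvesProblem2 (hs : IsLagrangeSaddle 𝔪 N P J)
    (hR : capacity 𝔪 N P J = ENNReal.ofReal R) {p : ℝ≥0} (hp : framePower 𝔪 P = p) :
    SolvesProblem2 𝔪 N R p P J where
  affordable := ⟨hs.tx_measurable, hp.le⟩
  measurable := hs.jx_measurable
  jammed := hR.le
  inner_opt := (hs.minJxPower_eq hR).symm
  outer_opt := (hs.minJxPower_eq hR).trans (hs.requiredJxPower_eq hR hp).symm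

end IsLagrangeSaddle

lemma requiredTxPower_mono (𝔪 : Measure ℝ) (N R : ℝ) : Monotone (requiredTxPower 𝔪 N R) :=
  fun _ _ hij => iSup₂_mono' fun J hJ => ⟨J, ⟨hJ.1, hJ.2.trans (by exact_mod_cast hij)⟩, le_rfl⟩

lemma requiredJxPower_mono (𝔪 : Measure ℝ) (N R : ℝ) : Monotone (requiredJxPower 𝔪 N R) :=
  fun _ _ hij => iSup₂_mono' fun J hJ => ⟨J, ⟨hJ.1, hJ.2.trans (by exact_mod_cast hij)⟩, le_rfl⟩

section Channel

variable {𝔪 : Measure ℝ} {N R : ℝ}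

/-! ### Capacities and mean powers of allocations -/

lemma measurable_rate {P J : Alloc} (hP : Measurable P) (hJ : Measurable J) :
    Measurable fun h : ℝ => ENNReal.ofReal (Real.log (1 + h * (P h : ℝ) / (N + (J h : ℝ)))) :=
  ((((measurable_id.mul hP.coe_nnreal_real).div
    (hJ.coe_nnreal_real.const_add N)).const_add 1).log).ennreal_ofReal

lemma rate_nonneg (hN : 0 < N) {h : ℝ} (hh : 0 < h) (x y : ℝ≥0) :
    0 ≤ Real.log (1 + h * (x : ℝ) / (N + (y : ℝ))) := by
  refine Real.log_nonneg ?_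
  have : 0 ≤ h * (x : ℝ) / (N + (y : ℝ)) := by positivity
  linarith

lemma capacity_add_mul_framePower {P J Q : Alloc} (hP : Measurable P) (hJ : Measurable J)
    (l : ℝ≥0) (hQ : Measurable Q) :
    capacity 𝔪 N P J + l * framePower 𝔪 Q =
      ∫⁻ h, (ENNReal.ofReal (Real.log (1 + h * (P h : ℝ) / (N + (J h : ℝ)))) + l * Q h) ∂𝔪 := by
  rw [lintegral_add_left (measurable_rate hP hJ), lintegral_const_mul _ hQ.coe_nnreal_ennreal]
  rfl

lemma ofReal_rate_add_mul (hN : 0 < N) {h : ℝ} (hh : 0 < h) (x y l z : ℝ≥0) :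
    ENNReal.ofReal (Real.log (1 + h * (x : ℝ) / (N + (y : ℝ)))) + (l : ℝ≥0∞) * z =
      ENNReal.ofReal (Real.log (1 + h * (x : ℝ) / (N + (y : ℝ))) + l * z) := by
  rw [ENNReal.ofReal_add (rate_nonneg hN hh x y) (by positivity),
    ENNReal.ofReal_mul l.coe_nonneg, ENNReal.ofReal_coe_nnreal, ENNReal.ofReal_coe_nnreal]

lemma framePower_add_const [IsProbabilityMeasure 𝔪] (P : Alloc) (δ : ℝ≥0) :
    framePower 𝔪 (fun h => P h + δ) = framePower 𝔪 P + δ := by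
  simp only [framePower, ENNReal.coe_add]
  rw [lintegral_add_right _ measurable_const]
  simp

/-- The formula of `jamAlloc` may be positive for `h < 0`, so this needs `h > 0` almost surely. -/
lemma framePower_jamAlloc_zero (h_pos : ∀ᵐ h ∂𝔪, 0 < h) (hN : 0 < N) {a : ℝ} (ha : 0 ≤ a) :
    framePower 𝔪 (jamAlloc N 0 a) = 0 := by
  rw [framePower, lintegral_eq_zero_iff (measurable_jamAlloc_apply N 0 a).coe_nnreal_ennreal]
  filter_upwards [h_pos] with h hh
  simp [jamAlloc_of_le hN ha hh (by simp : (0 : ℝ) * h ≤ 1)]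

lemma framePower_txAlloc_zero_mono (h_pos : ∀ᵐ h ∂𝔪, 0 < h) {a b : ℝ} (hN : 0 < N) (ha : 0 ≤ a)
    (hab : a ≤ b) : framePower 𝔪 (txAlloc N 0 a) ≤ framePower 𝔪 (txAlloc N 0 b) := by
  refine lintegral_mono_ae ?_
  filter_upwards [h_pos] with h hh
  exact_mod_cast txAlloc_zero_mono hN hab ha hh

lemma capacity_eq_zero {P : Alloc} (hP : Measurable P) (h0 : framePower 𝔪 P = 0) (J : Alloc) :
    capacity 𝔪 N P J = 0 := by
  have hz := (lintegral_eq_zero_iff hP.coe_nnreal_ennreal).1 h0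
  rw [capacity, lintegral_congr_ae (g := fun _ => 0), lintegral_zero]
  filter_upwards [hz] with h hh
  have : P h = 0 := ENNReal.coe_eq_zero.1 hh
  simp [this]

/-- Below the waterfilling power of the rate `R` the rate is not reached even without jamming. -/
lemma requiredJxPower_eq_zero (h_pos : ∀ᵐ h ∂𝔪, 0 < h) (hN : 0 < N) {b : ℝ} (hb : 0 ≤ b)
    (hs : IsLagrangeSaddle 𝔪 N (txAlloc N 0 b) (jamAlloc N 0 b))
    (hR : capacity 𝔪 N (txAlloc N 0 b) (jamAlloc N 0 b) = ENNReal.ofReal R) {p : ℝ≥0}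
    (hp : (p : ℝ≥0∞) ≤ framePower 𝔪 (txAlloc N 0 b)) : requiredJxPower 𝔪 N R p = 0 := by
  refine le_antisymm (iSup₂_le fun P' hP' => ?_) zero_le
  rw [← framePower_jamAlloc_zero h_pos hN hb]
  exact iInf₂_le _ ⟨hs.jx_measurable, hR ▸ hs.capacity_le hP'.1 (hP'.2.trans hp)⟩

/-- Below the waterfilling power of the rate `R` every affordable allocation solves the second
problem, with a jammer that spends nothing. -/
lemma solvesProblem2_waterfilling (h_pos : ∀ᵐ h ∂𝔪, 0 < h) (hN : 0 < N) {b : ℝ} (hb : 0 ≤ b)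
    (hs : IsLagrangeSaddle 𝔪 N (txAlloc N 0 b) (jamAlloc N 0 b))
    (hR : capacity 𝔪 N (txAlloc N 0 b) (jamAlloc N 0 b) = ENNReal.ofReal R) {p : ℝ≥0} {P : Alloc}
    (hP : Affordable 𝔪 p P)
    (hp : (p : ℝ≥0∞) ≤ framePower 𝔪 (txAlloc N 0 b)) :
    SolvesProblem2 𝔪 N R p P (jamAlloc N 0 b) := by
  have h0 := requiredJxPower_eq_zero h_pos hN hb hs hR hp
  have h1 : minJxPower 𝔪 N R P = 0 := by
    refine le_antisymm ?_ zero_le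
    rw [← h0]
    exact le_iSup₂_of_le P hP le_rfl
  exact ⟨hP, hs.jx_measurable, hR ▸ hs.capacity_le hP.1 (hP.2.trans hp),
    by rw [h1, framePower_jamAlloc_zero h_pos hN hb], by rw [h0, h1]⟩

/-- If `p ≥ 𝒫_M(j)`, an equilibrium allocation of the transmitter for `G(p, 𝒥_M(p))` guarantees
the rate `R` against every jammer allocation of power `j`. -/
lemma le_capacity_of_requiredTxPower_le {p j : ℝ≥0} {P₀ J₀ P₁ J₁ P J : Alloc}
    (hs₀ : IsLagrangeSaddle 𝔪 N P₀ J₀) (hR₀ : capacity 𝔪 N P₀ J₀ = ENNReal.ofReal R)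
    (hj : framePower 𝔪 J₀ = j)
    (hs₁ : IsLagrangeSaddle 𝔪 N P₁ J₁) (hR₁ : capacity 𝔪 N P₁ J₁ = ENNReal.ofReal R)
    (hp : framePower 𝔪 P₁ = p) (hle : requiredTxPower 𝔪 N R j ≤ p)
    (he : IsCapacityEquilibrium 𝔪 N p (requiredJxPower 𝔪 N R p) P J)
    {J' : Alloc} (hJ' : Affordable 𝔪 j J') : ENNReal.ofReal R ≤ capacity 𝔪 N P J' := by
  have h1 : (j : ℝ≥0∞) ≤ requiredJxPower 𝔪 N R p := by
    rw [hs₀.requiredTxPower_eq hR₀ hj] at hle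
    lift framePower 𝔪 P₀ to ℝ≥0 using hs₀.tx_finite with p₀ hp₀
    rw [← hj, ← hs₀.requiredJxPower_eq hR₀ hp₀.symm]
    exact requiredJxPower_mono 𝔪 N R (by exact_mod_cast hle)
  have h2 := hs₁.requiredJxPower_eq hR₁ hp
  calc ENNReal.ofReal R = capacity 𝔪 N P₁ J₁ := hR₁.symm
    _ ≤ capacity 𝔪 N P₁ J := hs₁.le_capacity he.jx_affordable.1 (h2 ▸ he.jx_affordable.2)
    _ ≤ capacity 𝔪 N P J := he.tx_best P₁ ⟨hs₁.tx_measurable, hp.le⟩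
    _ ≤ capacity 𝔪 N P J' := he.jx_best J' ⟨hJ'.1, hJ'.2.trans h1⟩

variable [IsProbabilityMeasure 𝔪]

/-! ### The family consists of saddle points of every power -/

lemma capacity_txAlloc_jamAlloc (h_pos : ∀ᵐ h ∂𝔪, 0 < h)
    (h_log : Integrable (fun h : ℝ => Real.log (1 + h)) 𝔪) (hN : 0 < N) {u a : ℝ} (hu : 0 ≤ u)
    (ha : 0 ≤ a) :
    capacity 𝔪 N (txAlloc N u a) (jamAlloc N u a) = ENNReal.ofReal (meanRate 𝔪 u a) := by
  rw [meanRate, ofReal_integral_eq_lintegral_ofReal (integrable_log_snrFactor h_pos h_log u ha)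
    (Filter.Eventually.of_forall fun h => Real.log_nonneg (le_max_left _ _)), capacity]
  refine lintegral_congr_ae ?_
  filter_upwards [h_pos] with h hh
  rw [one_add_snr_eq hN hu ha hh]

lemma framePower_txAlloc (h_pos : ∀ᵐ h ∂𝔪, 0 < h) (hN : 0 < N) {u a : ℝ} (hu : 0 ≤ u)
    (ha : 0 ≤ a) :
    framePower 𝔪 (txAlloc N u a) = ENNReal.ofReal (∫ h, (txAlloc N u a h : ℝ) ∂𝔪) :=
  lintegral_coe_eq_integral _ (integrable_txAlloc h_pos hN hu ha)

lemma framePower_jamAlloc (h_pos : ∀ᵐ h ∂𝔪, 0 < h) (hN : 0 < N) {u a : ℝ} (hu : 0 ≤ u)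
    (ha : 0 < a) :
    framePower 𝔪 (jamAlloc N u a) = ENNReal.ofReal (∫ h, (jamAlloc N u a h : ℝ) ∂𝔪) :=
  lintegral_coe_eq_integral _ (integrable_jamAlloc h_pos hN hu ha)

lemma isLagrangeSaddle (h_pos : ∀ᵐ h ∂𝔪, 0 < h)
    (h_log : Integrable (fun h : ℝ => Real.log (1 + h)) 𝔪) (hN : 0 < N) {u a : ℝ} (hu : 0 ≤ u)
    (ha : 0 < a) : IsLagrangeSaddle 𝔪 N (txAlloc N u a) (jamAlloc N u a) where
  tx_measurable := measurable_txAlloc_apply N u a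
  jx_measurable := measurable_jamAlloc_apply N u a
  tx_finite := by
    rw [framePower_txAlloc h_pos hN hu ha.le]
    exact ENNReal.ofReal_ne_top
  jx_finite := by
    rw [framePower_jamAlloc h_pos hN hu ha]
    exact ENNReal.ofReal_ne_top
  capacity_finite := by
    rw [capacity_txAlloc_jamAlloc h_pos h_log hN hu ha.le]
    exact ENNReal.ofReal_ne_top
  tx_multiplier := by
    have hl : 0 < (N * (a + u))⁻¹ := by positivity
    refine ⟨Real.toNNReal _, (Real.toNNReal_pos.2 hl).ne', fun P' hP' => ?_⟩
    have hP := measurable_txAlloc_apply N u a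
    have hJ := measurable_jamAlloc_apply N u a
    rw [capacity_add_mul_framePower hP' hJ _ hP, capacity_add_mul_framePower hP hJ _ hP']
    refine lintegral_mono_ae ?_
    filter_upwards [h_pos] with h hh
    rw [ofReal_rate_add_mul hN hh, ofReal_rate_add_mul hN hh, Real.coe_toNNReal _ hl.le]
    exact ENNReal.ofReal_le_ofReal (tx_pointwise hN hu ha hh (P' h).coe_nonneg)
  jx_multiplier := by
    have hl : 0 < a * (N * (a + u))⁻¹ := by positivity
    refine ⟨Real.toNNReal _, (Real.toNNReal_pos.2 hl).ne', fun J' hJ' => ?_⟩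
    have hP := measurable_txAlloc_apply N u a
    have hJ := measurable_jamAlloc_apply N u a
    rw [capacity_add_mul_framePower hP hJ _ hJ, capacity_add_mul_framePower hP hJ' _ hJ']
    refine lintegral_mono_ae ?_
    filter_upwards [h_pos] with h hh
    rw [ofReal_rate_add_mul hN hh, ofReal_rate_add_mul hN hh, Real.coe_toNNReal _ hl.le]
    exact ENNReal.ofReal_le_ofReal (jx_pointwise hN hu ha hh (J' h).coe_nonneg)

lemma capacity_lt_capacity_add_const (h_pos : ∀ᵐ h ∂𝔪, 0 < h) (hN : 0 < N) {P J : Alloc}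
    (hP : Measurable P) (hJ : Measurable J) {δ : ℝ≥0} (hδ : 0 < δ)
    (hfin : capacity 𝔪 N P J ≠ ∞) :
    capacity 𝔪 N P J < capacity 𝔪 N (fun h => P h + δ) J := by
  refine lintegral_strict_mono (IsProbabilityMeasure.ne_zero 𝔪)
    (measurable_rate (hP.add_const δ) hJ).aemeasurable hfin ?_
  filter_upwards [h_pos] with h hh
  have h1 : h * (P h : ℝ) / (N + (J h : ℝ)) < h * ((P h + δ : ℝ≥0) : ℝ) / (N + (J h : ℝ)) := by
    rw [NNReal.coe_add]
    have : (0 : ℝ) < δ := hδ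
    gcongr
    linarith
  have h2 : 0 ≤ h * (P h : ℝ) / (N + (J h : ℝ)) := by positivity
  have h3 : Real.log (1 + h * (P h : ℝ) / (N + (J h : ℝ))) <
      Real.log (1 + h * ((P h + δ : ℝ≥0) : ℝ) / (N + (J h : ℝ))) :=
    Real.log_lt_log (by linarith) (by linarith)
  exact (ENNReal.ofReal_lt_ofReal_iff ((rate_nonneg hN hh _ _).trans_lt h3)).2 h3

/-- The allocations `jamAlloc` along the level curve realize every jammer power, with a measurable
choice of the parameter. -/
lemma exists_jx_levels (h_pos : ∀ᵐ h ∂𝔪, 0 < h) (hN : 0 < N) {α : ℝ → ℝ}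
    (hα : Continuous α) (hanti : Antitone α) (hα0 : ∀ u, 0 < α u) :
    ∃ v : ℝ≥0 → ℝ, Measurable v ∧
      ∀ j, 0 ≤ v j ∧ framePower 𝔪 (jamAlloc N (v j) (α (v j))) = j := by
  have hcont := continuous_integral_jamAlloc h_pos hN (U := fun x => max x 0)
    (A := α) (by fun_prop) hα (fun x => le_max_right x 0) hα0
  have hzero : ∫ h, (jamAlloc N (max 0 0) (α 0) h : ℝ) ∂𝔪 = 0 := by
    rw [max_self]
    refine integral_eq_zero_of_ae ?_
    filter_upwards [h_pos] with h hh
    simp [jamAlloc_of_le hN (hα0 0).le hh (by simp : (0 : ℝ) * h ≤ 1)]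
  obtain ⟨v, hv, hv'⟩ := exists_monotone_rightInverse hcont hzero fun M => by
    obtain ⟨u, hu, hM⟩ := integral_jamAlloc_unbounded h_pos hN hα0 (fun x hx => hanti hx) M
    exact ⟨u, hu, by rwa [max_eq_left hu]⟩
  refine ⟨v, hv.measurable, fun j => ⟨(hv' j).1, ?_⟩⟩
  have h1 := (hv' j).2
  rw [max_eq_left (hv' j).1] at h1
  rw [framePower_jamAlloc h_pos hN (hv' j).1 (hα0 _), h1, ENNReal.ofReal_coe_nnreal]

/-- The allocations `txAlloc` realize every transmitter power, with a measurable choice of the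
parameters: by plain waterfilling (`U p = 0`) up to the point where the rate `R` is reached without
jamming, and along the level curve above that power. -/
lemma exists_tx_levels (h_pos : ∀ᵐ h ∂𝔪, 0 < h) (hN : 0 < N) {α : ℝ → ℝ} {a₁ : ℝ}
    (hα : Continuous α) (hanti : Antitone α) (ha₁ : 0 < a₁) (hαa₁ : ∀ u, 0 ≤ u → a₁ ≤ α u) :
    ∃ U A : ℝ≥0 → ℝ, Measurable U ∧ Measurable A ∧
      ∀ p, 0 ≤ U p ∧ 0 ≤ A p ∧ framePower 𝔪 (txAlloc N (U p) (A p)) = p ∧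
        (U p = 0 ∧ A p ≤ α 0 ∨ A p = α (U p)) := by
  -- one parameter `x ≥ 0`: the path `(0, x)` for `x ≤ α 0`, followed by the level curve
  set V : ℝ → ℝ := fun x => max (x - α 0) 0 with hV
  set B : ℝ → ℝ := fun x => max (min x (α (V x))) 0 with hB
  have hα00 : 0 < α 0 := ha₁.trans_le (hαa₁ 0 le_rfl)
  have hVc : Continuous V := by fun_prop
  have hBc : Continuous B := by fun_prop
  have hV0 : ∀ x, 0 ≤ V x := fun x => le_max_right _ _
  have hB0 : ∀ x, 0 ≤ B x := fun x => le_max_right _ _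
  have hlow : ∀ x, 0 ≤ x → x ≤ α 0 → V x = 0 ∧ B x = x := fun x hx hxa => by
    have h1 : V x = 0 := max_eq_right (by linarith)
    refine ⟨h1, ?_⟩
    simp only [hB, h1, min_eq_left hxa, max_eq_left hx]
  have hhigh : ∀ x, α 0 ≤ x → V x = x - α 0 ∧ B x = α (V x) := fun x hx => by
    refine ⟨max_eq_left (by linarith), ?_⟩
    have h2 : α (V x) ≤ α 0 := hanti (hV0 x)
    simp only [hB]
    rw [min_eq_right (h2.trans hx), max_eq_left (ha₁.le.trans (hαa₁ _ (hV0 x)))]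
  have hcont := continuous_integral_txAlloc h_pos hN hVc hBc hV0 hB0
  have hzero : ∫ h, (txAlloc N (V 0) (B 0) h : ℝ) ∂𝔪 = 0 := by
    rw [(hlow 0 le_rfl hα00.le).1, (hlow 0 le_rfl hα00.le).2]
    refine integral_eq_zero_of_ae ?_
    filter_upwards [h_pos] with h hh
    simp [txAlloc_zero_zero hN hh]
  obtain ⟨g, hg, hg'⟩ := exists_monotone_rightInverse hcont hzero fun M => by
    obtain ⟨u, hu, hM⟩ := integral_txAlloc_unbounded h_pos hN ha₁ hαa₁ M
    have h3 := hhigh (u + α 0) (by linarith)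
    have h4 : V (u + α 0) = u := by rw [h3.1]; ring
    exact ⟨u + α 0, by linarith, by rwa [h3.2, h4]⟩
  refine ⟨fun p => V (g p), fun p => B (g p), hVc.measurable.comp hg.measurable,
    hBc.measurable.comp hg.measurable, fun p => ⟨hV0 _, hB0 _, ?_, ?_⟩⟩
  · rw [framePower_txAlloc h_pos hN (hV0 _) (hB0 _), (hg' p).2, ENNReal.ofReal_coe_nnreal]
  · rcases le_total (g p) (α 0) with hle | hle
    · exact Or.inl ⟨(hlow _ (hg' p).1 hle).1, (hlow _ (hg' p).1 hle).2.trans_le hle⟩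
    · exact Or.inr (hhigh _ hle).2

/-! ### Equilibria without jamming and the Bayes equilibrium -/

/-- Waterfilling is optimal in the game without jamming. The level `a = 0` has no finite multiplier
and is treated apart: no power can be spent there. -/
lemma exists_equilibrium_waterfilling (h_pos : ∀ᵐ h ∂𝔪, 0 < h)
    (h_log : Integrable (fun h : ℝ => Real.log (1 + h)) 𝔪) (hN : 0 < N) {a : ℝ} (ha : 0 ≤ a)
    {p : ℝ≥0∞} (hp : framePower 𝔪 (txAlloc N 0 a) = p) :
    ∃ J, IsCapacityEquilibrium 𝔪 N p 0 (txAlloc N 0 a) J := by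
  refine ⟨jamAlloc N 0 a, ?_⟩
  rcases ha.eq_or_lt with rfl | ha
  · have h0 : framePower 𝔪 (txAlloc N 0 0) = 0 := by
      rw [framePower, lintegral_eq_zero_iff (measurable_txAlloc_apply N 0 0).coe_nnreal_ennreal]
      filter_upwards [h_pos] with h hh
      simp [txAlloc_zero_zero hN hh]
    rw [h0] at hp
    subst hp
    refine ⟨⟨measurable_txAlloc_apply _ _ _, h0.le⟩, ⟨measurable_jamAlloc_apply _ _ _,
      (framePower_jamAlloc_zero h_pos hN le_rfl).le⟩, fun P' hP' => ?_, fun J' _ => ?_⟩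
    · rw [capacity_eq_zero hP'.1 (le_antisymm hP'.2 zero_le)]
      exact zero_le
    · rw [capacity_eq_zero (measurable_txAlloc_apply _ _ _) h0]
      exact zero_le
  · have := (isLagrangeSaddle h_pos h_log hN le_rfl ha).isCapacityEquilibrium
    rwa [hp, framePower_jamAlloc_zero h_pos hN ha.le] at this

/-- If `p < 𝒫_M(j)`, an equilibrium allocation of the jammer for `G(𝒫_M(j), j)` keeps every
transmitter allocation of power `p` strictly below the rate `R`: the unspent power
`𝒫_M(j) - p` would otherwise buy a rate above `R`. -/
lemma capacity_lt_of_lt_requiredTxPower (h_pos : ∀ᵐ h ∂𝔪, 0 < h) (hN : 0 < N) {p j : ℝ≥0}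
    {P₀ J₀ P J : Alloc}
    (hs₀ : IsLagrangeSaddle 𝔪 N P₀ J₀) (hR₀ : capacity 𝔪 N P₀ J₀ = ENNReal.ofReal R)
    (hj : framePower 𝔪 J₀ = j) (hlt : p < requiredTxPower 𝔪 N R j)
    (he : IsCapacityEquilibrium 𝔪 N (requiredTxPower 𝔪 N R j) j P J)
    {P' : Alloc} (hP' : Affordable 𝔪 p P') : capacity 𝔪 N P' J < ENNReal.ofReal R := by
  have h2 := hs₀.requiredTxPower_eq hR₀ hj
  have hle : ∀ Q, Affordable 𝔪 (requiredTxPower 𝔪 N R j) Q →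
      capacity 𝔪 N Q J ≤ ENNReal.ofReal R := fun Q hQ =>
    calc capacity 𝔪 N Q J ≤ capacity 𝔪 N P J := he.tx_best Q hQ
      _ ≤ capacity 𝔪 N P J₀ := he.jx_best J₀ ⟨hs₀.jx_measurable, hj.le⟩
      _ ≤ capacity 𝔪 N P₀ J₀ := hs₀.capacity_le he.tx_affordable.1 (h2 ▸ he.tx_affordable.2)
      _ = ENNReal.ofReal R := hR₀
  have hfin : requiredTxPower 𝔪 N R j ≠ ∞ := h2 ▸ hs₀.tx_finite
  lift requiredTxPower 𝔪 N R j to ℝ≥0 using hfin with q hq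
  have hlt' : p < q := by exact_mod_cast hlt
  have hδ : 0 < q - p := tsub_pos_of_lt hlt'
  refine (capacity_lt_capacity_add_const h_pos hN hP'.1 he.jx_affordable.1 hδ ?_).trans_le
    (hle _ ⟨hP'.1.add_const _, ?_⟩)
  · exact ne_top_of_le_ne_top ENNReal.ofReal_ne_top
      (hle P' ⟨hP'.1, hP'.2.trans (by exact_mod_cast hlt.le)⟩)
  · rw [framePower_add_const]
    calc framePower 𝔪 P' + ((q - p : ℝ≥0) : ℝ≥0∞) ≤ p + ((q - p : ℝ≥0) : ℝ≥0∞) := by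
          gcongr
          exact hP'.2
      _ = q := by rw [← ENNReal.coe_add, add_tsub_cancel_of_le hlt'.le]

/-- Outage of a pair of equilibrium strategies is decided by the two powers alone, and no
deviation can change the outcome in favour of the deviating player; so the comparison of outage
events is pointwise in the type of the opponent. -/
lemma isBayesEquilibrium (h_pos : ∀ᵐ h ∂𝔪, 0 < h) (hN : 0 < N)
    (hjx : ∀ j : ℝ≥0, ∃ P J, IsLagrangeSaddle 𝔪 N P J ∧
      capacity 𝔪 N P J = ENNReal.ofReal R ∧ framePower 𝔪 J = j)
    (htx : ∀ p : ℝ≥0, requiredTxPower 𝔪 N R 0 ≤ p → ∃ P J, IsLagrangeSaddle 𝔪 N P J ∧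
      capacity 𝔪 N P J = ENNReal.ofReal R ∧ framePower 𝔪 P = p)
    {Ω : Type*} [MeasurableSpace Ω] (μ : Measure Ω) [IsFiniteMeasure μ] (P_M J_M : Ω → ℝ≥0)
    {s t : ℝ≥0 → Alloc} (hs : IsTxEquilibriumStrategy 𝔪 N R s)
    (ht : IsJxEquilibriumStrategy 𝔪 N R t) :
    IsBayesEquilibrium μ P_M J_M 𝔪 N R s t := by
  have hs_aff : ∀ p : ℝ≥0, Affordable 𝔪 p (s p) := fun p =>
    (hs.equilibrium p).choose_spec.tx_affordable
  have ht_aff : ∀ j : ℝ≥0, Affordable 𝔪 j (t j) := fun j =>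
    (ht.equilibrium j).choose_spec.jx_affordable
  have hgood : ∀ p j : ℝ≥0, requiredTxPower 𝔪 N R j ≤ p → ∀ J', Affordable 𝔪 j J' →
      ¬ Outage 𝔪 N R (s p) J' := fun p j hle J' hJ' => by
    obtain ⟨P₀, J₀, hs₀, hR₀, hj⟩ := hjx j
    obtain ⟨P₁, J₁, hs₁, hR₁, hp⟩ := htx p ((requiredTxPower_mono 𝔪 N R zero_le).trans hle)
    obtain ⟨J, he⟩ := hs.equilibrium p
    exact (le_capacity_of_requiredTxPower_le hs₀ hR₀ hj hs₁ hR₁ hp hle he hJ').not_gt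
  have hbad : ∀ p j : ℝ≥0, p < requiredTxPower 𝔪 N R j → ∀ P', Affordable 𝔪 p P' →
      Outage 𝔪 N R P' (t j) := fun p j hlt P' hP' => by
    obtain ⟨P₀, J₀, hs₀, hR₀, hj⟩ := hjx j
    obtain ⟨P, he⟩ := ht.equilibrium j
    exact capacity_lt_of_lt_requiredTxPower h_pos hN hs₀ hR₀ hj hlt he hP'
  refine ⟨⟨hs.measurable, hs_aff⟩, ⟨ht.measurable, ht_aff⟩,
    Filter.Eventually.of_forall fun p P hP => measure_mono fun j hout => ?_,
    Filter.Eventually.of_forall fun j J hJ => measure_mono fun p hout => ?_⟩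
  · rcases le_or_gt (requiredTxPower 𝔪 N R j) p with hle | hlt
    · exact absurd hout (hgood p j hle (t j) (ht_aff j))
    · exact hbad p j hlt P hP
  · rcases le_or_gt (requiredTxPower 𝔪 N R j) p with hle | hlt
    · exact absurd hout (hgood p j hle J hJ)
    · exact hbad p j hlt (s p) (hs_aff p)

end Channel

end JammingGame

theorem mainTheorem11
    -- the law of the channel coefficient: it has a density and lives on the half-line
    (𝔪 : Measure ℝ) [IsProbabilityMeasure 𝔪]
    (h_density : 𝔪 ≪ volume) (h_nonneg : ∀ᵐ h ∂𝔪, 0 ≤ h)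
    -- the ergodic capacity is finite
    (h_log : Integrable (fun h : ℝ => Real.log (1 + h)) 𝔪)
    (σsq R : ℝ) (hσ : 0 < σsq) (hR : 0 < R)
    -- the random frame powers
    {Ω : Type*} [MeasurableSpace Ω] (μ : Measure Ω) [IsProbabilityMeasure μ]
    (P_M J_M : Ω → ℝ≥0) (hP : Measurable P_M) (hJ : Measurable J_M) :
    -- the two max-min problems have solutions, with finite values
    (∀ j : ℝ≥0, JammingGame.requiredTxPower 𝔪 σsq R j ≠ ∞ ∧
      ∃ P J, JammingGame.SolvesProblem1 𝔪 σsq R j P J) ∧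
    (∀ p : ℝ≥0, JammingGame.requiredJxPower 𝔪 σsq R p ≠ ∞ ∧
      ∃ P J, JammingGame.SolvesProblem2 𝔪 σsq R p P J) ∧
    -- the prescribed strategies exist
    (∃ s, JammingGame.IsTxEquilibriumStrategy 𝔪 σsq R s) ∧
    (∃ t, JammingGame.IsJxEquilibriumStrategy 𝔪 σsq R t) ∧
    -- and they form a Bayes equilibrium
    (∀ s t, JammingGame.IsTxEquilibriumStrategy 𝔪 σsq R s →
      JammingGame.IsJxEquilibriumStrategy 𝔪 σsq R t →
      JammingGame.IsBayesEquilibrium μ P_M J_M 𝔪 σsq R s t) := by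
  have h_pos : ∀ᵐ h ∂𝔪, 0 < h := by
    have hne : ∀ᵐ h ∂𝔪, h ≠ 0 := h_density.ae_le (Measure.ae_ne volume (0 : ℝ))
    filter_upwards [h_nonneg, hne] with h h1 h2 using lt_of_le_of_ne h1 h2.symm
  obtain ⟨α, hαc, hanti, hα0, hαR⟩ := JammingGame.exists_levelCurve h_pos h_log hR
  obtain ⟨a₁, ha₁, hlow⟩ := JammingGame.exists_pos_le_of_meanRate_eq h_pos h_log hR
  have hαa₁ : ∀ u, 0 ≤ u → a₁ ≤ α u := fun u hu => hlow u _ (hα0 u).le (hαR u hu)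
  have hsad : ∀ u, 0 ≤ u → JammingGame.IsLagrangeSaddle 𝔪 σsq
      (JammingGame.txAlloc σsq u (α u)) (JammingGame.jamAlloc σsq u (α u)) := fun u hu =>
    JammingGame.isLagrangeSaddle h_pos h_log hσ hu (hα0 u)
  have hcap : ∀ u, 0 ≤ u → JammingGame.capacity 𝔪 σsq
      (JammingGame.txAlloc σsq u (α u)) (JammingGame.jamAlloc σsq u (α u)) =
        ENNReal.ofReal R := fun u hu => by
    rw [JammingGame.capacity_txAlloc_jamAlloc h_pos h_log hσ hu (hα0 u).le, hαR u hu]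
  obtain ⟨v, hv, hv'⟩ := JammingGame.exists_jx_levels h_pos hσ hαc hanti hα0
  obtain ⟨U, A, hU, hA, hUA⟩ := JammingGame.exists_tx_levels h_pos hσ hαc hanti ha₁ hαa₁
  have hp₀ : JammingGame.requiredTxPower 𝔪 σsq R 0 =
      JammingGame.framePower 𝔪 (JammingGame.txAlloc σsq 0 (α 0)) :=
    (hsad 0 le_rfl).requiredTxPower_eq (hcap 0 le_rfl)
      (by simpa using JammingGame.framePower_jamAlloc_zero h_pos hσ (hα0 0).le)
  -- a type below the waterfilling power of rate `R` has `U p = 0`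
  have hwf : ∀ p, U p = 0 → A p ≤ α 0 →
      (p : ℝ≥0∞) ≤ JammingGame.framePower 𝔪 (JammingGame.txAlloc σsq 0 (α 0)) := by
    intro p h1 h2
    obtain ⟨-, hA0, hpow, -⟩ := hUA p
    rw [← hpow, h1]
    exact JammingGame.framePower_txAlloc_zero_mono h_pos hσ hA0 h2
  refine ⟨fun j => ?_, fun p => ?_, ?_, ?_, fun s t hs ht => ?_⟩
  · obtain ⟨h0, hpow⟩ := hv' j
    refine ⟨?_, _, _, (hsad _ h0).solvesProblem1 (hcap _ h0) hpow⟩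
    rw [(hsad _ h0).requiredTxPower_eq (hcap _ h0) hpow]
    exact (hsad _ h0).tx_finite
  · obtain ⟨hU0, hA0, hpow, ⟨h1, h2⟩ | h1⟩ := hUA p
    · refine ⟨?_, _, _, JammingGame.solvesProblem2_waterfilling h_pos hσ (hα0 0).le
        (hsad 0 le_rfl) (hcap 0 le_rfl)
        ⟨JammingGame.measurable_txAlloc_apply σsq (U p) (A p), hpow.le⟩ (hwf p h1 h2)⟩
      rw [JammingGame.requiredJxPower_eq_zero h_pos hσ (hα0 0).le
        (hsad 0 le_rfl) (hcap 0 le_rfl) (hwf p h1 h2)]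
      exact ENNReal.zero_ne_top
    · rw [h1] at hpow
      refine ⟨?_, _, _, (hsad _ hU0).solvesProblem2 (hcap _ hU0) hpow⟩
      rw [(hsad _ hU0).requiredJxPower_eq (hcap _ hU0) hpow]
      exact (hsad _ hU0).jx_finite
  · refine ⟨fun p => JammingGame.txAlloc σsq (U p) (A p), ?_, fun p => ?_⟩
    · exact (JammingGame.measurable_txAlloc σsq).comp
        ((hU.comp measurable_fst).prodMk ((hA.comp measurable_fst).prodMk measurable_snd))
    · obtain ⟨hU0, hA0, hpow, ⟨h1, h2⟩ | h1⟩ := hUA p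
      · rw [JammingGame.requiredJxPower_eq_zero h_pos hσ (hα0 0).le
          (hsad 0 le_rfl) (hcap 0 le_rfl) (hwf p h1 h2), h1]
        rw [h1] at hpow
        exact JammingGame.exists_equilibrium_waterfilling h_pos h_log hσ hA0 hpow
      · rw [h1] at hpow ⊢
        rw [(hsad _ hU0).requiredJxPower_eq (hcap _ hU0) hpow, ← hpow]
        exact ⟨_, (hsad _ hU0).isCapacityEquilibrium⟩
  · refine ⟨fun j => JammingGame.jamAlloc σsq (v j) (α (v j)), ?_, fun j => ?_⟩
    · exact (JammingGame.measurable_jamAlloc σsq).comp ((hv.comp measurable_fst).prodMk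
        (((hαc.measurable.comp hv).comp measurable_fst).prodMk measurable_snd))
    · obtain ⟨h0, hpow⟩ := hv' j
      rw [(hsad _ h0).requiredTxPower_eq (hcap _ h0) hpow, ← hpow]
      exact ⟨_, (hsad _ h0).isCapacityEquilibrium⟩
  · refine JammingGame.isBayesEquilibrium h_pos hσ (fun j => ?_) (fun p hp => ?_) μ P_M J_M hs ht
    · exact ⟨_, _, hsad _ (hv' j).1, hcap _ (hv' j).1, (hv' j).2⟩
    · obtain ⟨hU0, hA0, hpow, ⟨h1, h2⟩ | h1⟩ := hUA p
      · exact ⟨_, _, hsad 0 le_rfl, hcap 0 le_rfl, le_antisymm (hp₀ ▸ hp) (hwf p h1 h2)⟩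
      · rw [h1] at hpow
        exact ⟨_, _, hsad _ hU0, hcap _ hU0, hpow⟩
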